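/- An environment $\Gamma=(c,\mu)$ consists of a compact set $V\subset\mathbb R$ with $\min V<\max V$, a probability measure $\mu$ on $V$ with support $V$, and a continuous function $c:V\to\mathbb R$ with $v-c(v)\ge 0$ for all $v\in V$ and $\mathbb E_\mu[v-c(v)]>0$. An information structure $\tau$ consists of Polish (complete separable metric) spaces $T_s,T_b$ with their Borel $\sigma$-algebras and a probability measure $P$ on $T_s\times T_b\times V$ whose marginal on $V$ is $\mu$. In the game $(\Gamma,\tau)$, $(t_s,t_b,v)$ is drawn from $P$; Seller observes $t_s$ and posts a price $p\in\mathbb R$; Buyer observes $(p,t_b)$ and accepts or rejects. If he accepts, Buyer gets $v-p$ and Seller gets $p-c(v)$; otherwise both get $0$. A strategy of Seller is a joint distribution $\sigma$ of $(p,t_s)$ whose marginal on $T_s$ is that of $P$, and $\sigma(\cdot\mid t_s)$ is the induced conditional price distribution; a strategy of Buyer is a measurable acceptance probability $\alpha:\mathbb R\times T_b\to[0,1]$. The expected payoffs are $$\pi_b=\int (v-p)\,\alpha(p,t_b)\,\sigma(dp\mid t_s)P(dt_s,dt_b,dv),\qquad \pi_s=\int (p-c(v))\,\alpha(p,t_b)\,\sigma(dp\mid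 t_s)P(dt_s,dt_b,dv).$$ A weak perfect Bayesian equilibrium (equilibrium, for short) is a strategy profile $(\sigma,\alpha)$ with finite payoffs, together with a belief kernel $\nu(\cdot\mid p,t_b)\in\Delta(V)$, such that (i) for all $(p,t_b)$, $\alpha(p,t_b)=1$ if $\mathbb E_{\nu(\cdot\mid p,t_b)}[v]>p$ and $\alpha(p,t_b)=0$ if $\mathbb E_{\nu(\cdot\mid p,t_b)}[v]<p$; (ii) $\sigma$ maximizes Seller's expected payoff against $\alpha$; (iii) $\nu$ satisfies Bayes' rule on path, i.e. for the joint distribution of $(p,t_b,v)$ generated by $\sigma$ and $P$, $\nu(\cdot\mid p,t_b)$ is a conditional distribution of $v$ given $(p,t_b)$. It has price-independent beliefs if, for every price $p\in\mathbb R$, $\nu(\cdot\mid p,\cdot)$ is a version of the conditional distribution of $v$ given $t_b$ under $P$. Let $\mathbf\Pi(\Gamma)$ be the set of payoff pairs $(\pi_b,\pi_s)$ of equilibria of $(\Gamma,\tau)$ over all $\tau$, let $\Pi^*(\Gamma,\tau)$ be the set of payoff pairs of equilibria of $(\Gamma,\tau)$ with price-independent beliefs, and let $\mathbf\Pi^*(\Gamma)$,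 $\mathbf\Pi^*_{mb}(\Gamma)$ and $\mathbf\Pi^*_{us}(\Gamma)$ be the unions of $\Pi^*(\Gamma,\tau)$ over, respectively, all $\tau$; all $\tau$ with more-informed Buyer ($v$ and $t_s$ are independent conditional on $t_b$); and all $\tau$ with uninformed Seller ($T_s$ is a singleton). Let $$\underline\pi_s^{us}(\Gamma)=\inf\{\pi_s:(\pi_b,\pi_s)\in\mathbf\Pi^*_{us}(\Gamma)\text{ for some }\pi_b\}.$$ **Theorem.** For every environment $\Gamma$: 1. $\mathbf\Pi^*(\Gamma)=\mathbf\Pi^*_{mb}(\Gamma)=\mathbf\Pi^*_{us}(\Gamma)$. 2. $\mathbf\Pi^*_{us}(\Gamma)=\{(\pi_b,\pi_s)\in\mathbf\Pi(\Gamma):\pi_s\ge\underline\pi_s^{us}(\Gamma)\}$, and the infimum $\underline\pi_s^{us}(\Gamma)$ is attained (in particular it is the infimum of a nonempty set). 3. For every $(\pi_b,\pi_s)\in\mathbf\Pi^*_{us}(\Gamma)$ with $\pi_s>\underline\pi_s^{us}(\Gamma)$ there is an information structure $\tau$ with uninformed Seller such that $\Pi^*(\Gamma,\tau)=\{(\pi_b,\pi_s)\}$.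 -/

import Mathlib

open MeasureTheory ProbabilityTheory

noncomputable section

namespace BilateralTrade

/-- An environment `Γ = (c, μ)`: a compact set `V ⊆ ℝ` of buyer values with `min V < max V`,
a probability measure `μ` on `V` whose support is `V`, and a continuous cost function `c` on `V`
such that the surplus `v - c v` is nonnegative on `V` and has positive expectation. -/
structure Environment where
  V : Set ℝ
  isCompact_V : IsCompact V
  nontrivial_V : V.Nontrivial
  μ : Measure V
  isProbabilityMeasure_μ : IsProbabilityMeasure μ
  support_μ : μ.support = Set.univ
  c : V → ℝ
  continuous_c : Continuous c
  c_le : ∀ v : V, c v ≤ (v : ℝ)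
  surplus_pos : 0 < ∫ v : V, ((v : ℝ) - c v) ∂μ

instance (Γ : Environment) : IsProbabilityMeasure Γ.μ := Γ.isProbabilityMeasure_μ

instance (Γ : Environment) : CompactSpace Γ.V := isCompact_iff_compactSpace.1 Γ.isCompact_V

/-- An information structure: Polish signal spaces with their Borel sigma-algebras and a joint
distribution `P` of `(t_s, t_b, v)` whose marginal on values is the prior. -/
structure InfoStructure (Γ : Environment) where
  Ts : Type
  Tb : Type
  topTs : TopologicalSpace Ts
  topTb : TopologicalSpace Tb
  polishTs : PolishSpace Ts
  polishTb : PolishSpace Tb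
  measTs : MeasurableSpace Ts
  measTb : MeasurableSpace Tb
  borelTs : BorelSpace Ts
  borelTb : BorelSpace Tb
  P : Measure (Ts × Tb × Γ.V)
  isProbabilityMeasure_P : IsProbabilityMeasure P
  marginal_value : P.map (fun x => x.2.2) = Γ.μ

attribute [instance] InfoStructure.topTs InfoStructure.topTb InfoStructure.polishTs
  InfoStructure.polishTb InfoStructure.measTs InfoStructure.measTb InfoStructure.borelTs
  InfoStructure.borelTb InfoStructure.isProbabilityMeasure_P

variable {Γ : Environment}

/-- A distributional strategy of Seller: a joint distribution of her signal and the price whose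
marginal on signals is her signal distribution. -/
structure SellerStrategy (τ : InfoStructure Γ) where
  law : Measure (τ.Ts × ℝ)
  isProbabilityMeasure_law : IsProbabilityMeasure law
  fst_law : law.fst = τ.P.fst

attribute [instance] SellerStrategy.isProbabilityMeasure_law

/-- The price distribution `σ(dp | t_s)` given Seller's signal. -/
def SellerStrategy.priceKernel {τ : InfoStructure Γ} (σ : SellerStrategy τ) : Kernel τ.Ts ℝ :=
  σ.law.condKernel

/-- A strategy of Buyer: the probability `α(p, t_b)` of accepting the price `p` given the
signal `t_b`. -/
structure BuyerStrategy (τ : InfoStructure Γ) where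
  prob : ℝ × τ.Tb → ℝ
  measurable_prob : Measurable prob
  prob_mem : ∀ x, prob x ∈ Set.Icc (0 : ℝ) 1

/-- The joint distribution `σ(dp | t_s) P(dt_s, dt_b, dv)` of `((t_s, t_b, v), p)`. -/
def outcome (τ : InfoStructure Γ) (σ : SellerStrategy τ) :
    Measure ((τ.Ts × τ.Tb × Γ.V) × ℝ) :=
  τ.P ⊗ₘ (σ.priceKernel.comap Prod.fst measurable_fst)

/-- Buyer's realised payoff: `(v - p) α(p, t_b)`. -/
def buyerGain {τ : InfoStructure Γ} (α : BuyerStrategy τ)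
    (x : (τ.Ts × τ.Tb × Γ.V) × ℝ) : ℝ :=
  ((x.1.2.2 : ℝ) - x.2) * α.prob (x.2, x.1.2.1)

/-- Seller's realised payoff: `(p - c v) α(p, t_b)`. -/
def sellerGain {τ : InfoStructure Γ} (α : BuyerStrategy τ)
    (x : (τ.Ts × τ.Tb × Γ.V) × ℝ) : ℝ :=
  (x.2 - Γ.c x.1.2.2) * α.prob (x.2, x.1.2.1)

/-- Buyer's ex-ante expected payoff. -/
def buyerPayoff {τ : InfoStructure Γ} (σ : SellerStrategy τ) (α : BuyerStrategy τ) : ℝ :=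
  ∫ x, buyerGain α x ∂(outcome τ σ)

/-- Seller's ex-ante expected payoff. -/
def sellerPayoff {τ : InfoStructure Γ} (σ : SellerStrategy τ) (α : BuyerStrategy τ) : ℝ :=
  ∫ x, sellerGain α x ∂(outcome τ σ)

/-- Both expected payoffs are well-defined real numbers under `(σ, α)`. -/
def PayoffsDefined {τ : InfoStructure Γ} (σ : SellerStrategy τ) (α : BuyerStrategy τ) : Prop :=
  Integrable (buyerGain α) (outcome τ σ) ∧ Integrable (sellerGain α) (outcome τ σ)

/-- Weak perfect Bayesian equilibrium `(σ, α, ν)`; `ν (p, t_b)` is Buyer's belief about `v`.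
Against an `α` satisfying `buyer_opt`, Seller's realised payoff is bounded above, so a deviation
whose payoff is not defined has expected payoff `-∞`; disregarding it is no restriction. -/
structure IsWPBE {τ : InfoStructure Γ} (σ : SellerStrategy τ) (α : BuyerStrategy τ)
    (ν : Kernel (ℝ × τ.Tb) Γ.V) : Prop where
  isMarkovKernel : IsMarkovKernel ν
  payoffsDefined : PayoffsDefined σ α
  buyer_opt : ∀ (p : ℝ) (t : τ.Tb),
    (p < ∫ v : Γ.V, (v : ℝ) ∂(ν (p, t)) → α.prob (p, t) = 1) ∧
    (∫ v : Γ.V, (v : ℝ) ∂(ν (p, t)) < p → α.prob (p, t) = 0)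
  seller_opt : ∀ σ' : SellerStrategy τ, PayoffsDefined σ' α →
    sellerPayoff σ' α ≤ sellerPayoff σ α
  bayes : ((outcome τ σ).map fun x => (x.2, x.1.2.1)) ⊗ₘ ν =
    (outcome τ σ).map fun x => ((x.2, x.1.2.1), x.1.2.2)

/-- Price-independent beliefs: whatever the price `p`, the belief `ν (p, ·)` is a version of the
conditional distribution of `v` given `t_b`. -/
def PriceIndependent {τ : InfoStructure Γ} (ν : Kernel (ℝ × τ.Tb) Γ.V) : Prop :=
  ∀ p : ℝ, τ.P.snd.fst ⊗ₘ (ν.comap (fun t => (p, t)) measurable_prodMk_left) = τ.P.snd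

/-- `Π(Γ, τ)`: pairs (Buyer's payoff, Seller's payoff) of equilibria of the game `(Γ, τ)`. -/
def eqPayoffs (τ : InfoStructure Γ) : Set (ℝ × ℝ) :=
  {π | ∃ (σ : SellerStrategy τ) (α : BuyerStrategy τ) (ν : Kernel (ℝ × τ.Tb) Γ.V),
    IsWPBE σ α ν ∧ π = (buyerPayoff σ α, sellerPayoff σ α)}

/-- `Π*(Γ, τ)`: payoff pairs of equilibria with price-independent beliefs. -/
def eqPayoffsStar (τ : InfoStructure Γ) : Set (ℝ × ℝ) :=
  {π | ∃ (σ : SellerStrategy τ) (α : BuyerStrategy τ) (ν : Kernel (ℝ × τ.Tb) Γ.V),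
    IsWPBE σ α ν ∧ PriceIndependent ν ∧ π = (buyerPayoff σ α, sellerPayoff σ α)}

/-- Uninformed Seller: `T_s` is a singleton (it is nonempty because it carries a probability). -/
def UninformedSeller (τ : InfoStructure Γ) : Prop := Subsingleton τ.Ts

/-- More-informed Buyer: `v` and `t_s` are independent conditional on `t_b`. -/
def MoreInformedBuyer (τ : InfoStructure Γ) : Prop :=
  CondIndepFun (MeasurableSpace.comap (fun x : τ.Ts × τ.Tb × Γ.V => x.2.1) inferInstance)
    (measurable_fst.comp measurable_snd).comap_le
    (fun x : τ.Ts × τ.Tb × Γ.V => x.1) (fun x : τ.Ts × τ.Tb × Γ.V => x.2.2) τ.P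

variable (Γ)

/-- Equilibrium payoff pairs over all information structures. -/
def implementable : Set (ℝ × ℝ) := ⋃ τ : InfoStructure Γ, eqPayoffs τ

/-- Payoff pairs of equilibria with price-independent beliefs, over all information structures. -/
def implementableStar : Set (ℝ × ℝ) := ⋃ τ : InfoStructure Γ, eqPayoffsStar τ

/-- The same over more-informed-Buyer information structures. -/
def implementableStarMB : Set (ℝ × ℝ) :=
  ⋃ τ ∈ {τ : InfoStructure Γ | MoreInformedBuyer τ}, eqPayoffsStar τ

/-- The same over uninformed-Seller information structures. -/
def implementableStarUS : Set (ℝ × ℝ) :=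
  ⋃ τ ∈ {τ : InfoStructure Γ | UninformedSeller τ}, eqPayoffsStar τ

/-- The seller payoffs in `implementableStarUS`. -/
def sellerPayoffsUS : Set ℝ := {s | ∃ b, (b, s) ∈ implementableStarUS Γ}

/-- The infimum payoff of an uninformed Seller. -/
def sellerFloorUS : ℝ := sInf (sellerPayoffsUS Γ)

end BilateralTrade

end

/-!
# Price-independent beliefs in bilateral trade with adverse selection

All three parts follow from one description: with `S` the total surplus and `t₀` the least profit
cap of an experiment, each of the three sets of payoff pairs consists of the `(b, s)` with `0 ≤ b`,
`t₀ ≤ s` and `b + s ≤ S`.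

An *experiment* (`IsExperiment`) is a joint law `G` of Buyer's estimate `m = E[v | t_b]` and the
value `v`; it is *capped* by `t` (`Caps`) if no posted price `p` earns more than `t` from the types
`m > p`.

* Necessity. In any equilibrium Buyer accepts only prices below his expected value, so `0 ≤ b`, and
  `b + s` is realised surplus, so `b + s ≤ S`. If beliefs are price-independent, every constant
  price, even off path, meets the same demand, namely `m` against `p`; so the experiment induced by
  Buyer's signal is capped by `s` (`IsWPBE.caps`). Seller's own information can only help her here.
* Least cap. On a compact interval of estimates, experiments form a weakly compact set, and being
  capped by `t` is a closed condition once demands are replaced by their averages over short price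
  intervals (`exists_least_cap`).
* Sufficiency. Starting from an experiment capped by `t ≤ s`, pooling intermediate estimates at a
  single price `z` makes `z` optimal with payoffs `(b, s)`, and uniquely optimal when `t < s`
  (`exists_experiment_of_caps`). An uninformed Seller facing a Buyer who observes the estimate
  then has `(b, s)` as an equilibrium payoff (`mem_eqPayoffsStar_ofExperiment`), and as the only one
  when `z` is the unique optimum (`eqPayoffsStar_ofExperiment_subset`), because how indifferent
  types behave affects neither Buyer's payoff nor, at the optimum, Seller's.
-/

noncomputable section

open Filter Topology

namespace BilateralTrade

/-! ### Cutoff rules -/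

/-- The cutoff rule at `y`: weight `1` above `y`, weight `θ` at `y`, weight `0` below. The weight
`θ` stands for the randomisation needed to split an atom at `y`; `cutoff p 1` and `cutoff p 0` are
the demands at price `p` of a buyer with estimate `m` who accepts, respectively rejects, when
indifferent. -/
def cutoff (y θ m : ℝ) : ℝ := if y < m then 1 else if m = y then θ else 0

lemma measurable_cutoff (y θ : ℝ) : Measurable (cutoff y θ) :=
  Measurable.ite measurableSet_Ioi measurable_const
    (Measurable.ite (measurableSet_singleton y) measurable_const measurable_const)

lemma cutoff_of_lt {y m : ℝ} (θ : ℝ) (h : y < m) : cutoff y θ m = 1 := if_pos h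

lemma cutoff_self (y θ : ℝ) : cutoff y θ y = θ := by simp [cutoff]

lemma cutoff_of_gt {y m : ℝ} (θ : ℝ) (h : m < y) : cutoff y θ m = 0 := by
  simp [cutoff, h.not_gt, h.ne]

lemma cutoff_one_of_le {y m : ℝ} (h : y ≤ m) : cutoff y 1 m = 1 := by
  rcases h.lt_or_eq with h | rfl
  · exact cutoff_of_lt _ h
  · exact cutoff_self _ _

lemma cutoff_zero_of_le {y m : ℝ} (h : m ≤ y) : cutoff y 0 m = 0 := by
  rcases h.lt_or_eq with h | rfl
  · exact cutoff_of_gt _ h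
  · exact cutoff_self _ _

lemma cutoff_nonneg {θ : ℝ} (h : 0 ≤ θ) (y m : ℝ) : 0 ≤ cutoff y θ m := by
  unfold cutoff; split_ifs <;> simp [h]

lemma cutoff_le_one {θ : ℝ} (h : θ ≤ 1) (y m : ℝ) : cutoff y θ m ≤ 1 := by
  unfold cutoff; split_ifs <;> simp [h]

lemma abs_cutoff_le_one {θ : ℝ} (h0 : 0 ≤ θ) (h1 : θ ≤ 1) (y m : ℝ) : |cutoff y θ m| ≤ 1 := by
  rw [abs_of_nonneg (cutoff_nonneg h0 y m)]
  exact cutoff_le_one h1 y m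

lemma cutoff_eq_combination (y θ m : ℝ) :
    cutoff y θ m = (1 - θ) * cutoff y 0 m + θ * cutoff y 1 m := by
  unfold cutoff; split_ifs <;> ring

lemma tendsto_cutoff_right (y θ m : ℝ) :
    Tendsto (fun u => cutoff u θ m) (𝓝[>] y) (𝓝 (cutoff y 0 m)) := by
  refine tendsto_const_nhds.congr' ?_
  rcases le_or_gt m y with h | h
  · filter_upwards [self_mem_nhdsWithin] with u hu
    rw [cutoff_zero_of_le h, cutoff_of_gt _ (lt_of_le_of_lt h hu)]
  · filter_upwards [mem_nhdsWithin_of_mem_nhds (Iio_mem_nhds h)] with u hu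
    rw [cutoff_of_lt _ h, cutoff_of_lt _ hu]

lemma tendsto_cutoff_left (y θ m : ℝ) :
    Tendsto (fun u => cutoff u θ m) (𝓝[<] y) (𝓝 (cutoff y 1 m)) := by
  refine tendsto_const_nhds.congr' ?_
  rcases le_or_gt y m with h | h
  · filter_upwards [self_mem_nhdsWithin] with u hu
    rw [cutoff_one_of_le h, cutoff_of_lt _ (lt_of_lt_of_le hu h)]
  · filter_upwards [mem_nhdsWithin_of_mem_nhds (Ioi_mem_nhds h)] with u hu
    rw [cutoff_of_gt _ h, cutoff_of_gt _ hu]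

lemma integrable_mul_weight {X : Type*} [MeasurableSpace X] {ρ : Measure X} {f w : X → ℝ}
    (hf : Integrable f ρ) (hw : Measurable w) (hw1 : ∀ x, |w x| ≤ 1) :
    Integrable (fun x => f x * w x) ρ :=
  hf.mul_bdd (c := 1) hw.aestronglyMeasurable (ae_of_all _ fun x => by simpa using hw1 x)

lemma integrable_mul_cutoff {X : Type*} [MeasurableSpace X] {ρ : Measure X} {f k : X → ℝ}
    (hf : Integrable f ρ) (hk : Measurable k) {θ : ℝ} (h0 : 0 ≤ θ) (h1 : θ ≤ 1) (y : ℝ) :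
    Integrable (fun x => f x * cutoff y θ (k x)) ρ :=
  integrable_mul_weight hf ((measurable_cutoff y θ).comp hk) fun _ => abs_cutoff_le_one h0 h1 _ _

lemma integral_mul_cutoff_eq_combination {X : Type*} [MeasurableSpace X] {ρ : Measure X}
    {f k : X → ℝ} (hf : Integrable f ρ) (hk : Measurable k) (y θ : ℝ) :
    ∫ x, f x * cutoff y θ (k x) ∂ρ =
      (1 - θ) * ∫ x, f x * cutoff y 0 (k x) ∂ρ + θ * ∫ x, f x * cutoff y 1 (k x) ∂ρ := by
  rw [← integral_const_mul, ← integral_const_mul, ← integral_add]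
  · refine integral_congr_ae (ae_of_all _ fun x => ?_)
    simp only [cutoff_eq_combination y θ]
    ring
  · exact (integrable_mul_cutoff hf hk le_rfl zero_le_one y).const_mul _
  · exact (integrable_mul_cutoff hf hk zero_le_one le_rfl y).const_mul _

/-- Generalised inverse of a tail integral: any target between `0` and the whole integral of
`f ≥ 0` is the integral of `f` against a cutoff rule in `k`. -/
lemma exists_cutoff_integral_eq {X : Type*} [MeasurableSpace X] {ρ : Measure X} {f k : X → ℝ}
    (hf : Integrable f ρ) (hf0 : ∀ᵐ x ∂ρ, 0 ≤ f x) (hk : Measurable k) {lo hi : ℝ}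
    (hlo : ∀ᵐ x ∂ρ, k x < lo → f x = 0) (hhi : ∀ᵐ x ∂ρ, hi < k x → f x = 0)
    {t : ℝ} (ht0 : 0 ≤ t) (ht : t ≤ ∫ x, f x ∂ρ) :
    ∃ y θ, lo ≤ y ∧ 0 ≤ θ ∧ θ ≤ 1 ∧ ∫ x, f x * cutoff y θ (k x) ∂ρ = t := by
  set g : ℝ → ℝ := fun u => ∫ x, f x * cutoff u 0 (k x) ∂ρ with hg
  set g' : ℝ → ℝ := fun u => ∫ x, f x * cutoff u 1 (k x) ∂ρ with hg'
  have hint0 := integrable_mul_cutoff hf hk le_rfl (zero_le_one (α := ℝ))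
  have hdct : ∀ (l : Filter ℝ) [l.IsCountablyGenerated] (y θ : ℝ),
      (∀ m, Tendsto (fun u => cutoff u 0 m) l (𝓝 (cutoff y θ m))) →
      Tendsto g l (𝓝 (∫ x, f x * cutoff y θ (k x) ∂ρ)) := by
    intro l _ y θ h
    refine tendsto_integral_filter_of_dominated_convergence (fun x => |f x|)
      (Eventually.of_forall fun u => (hint0 u).aestronglyMeasurable)
      (Eventually.of_forall fun u => ae_of_all _ fun x => ?_) hf.abs
      (ae_of_all _ fun x => (h (k x)).const_mul _)
    rw [norm_mul, Real.norm_eq_abs, Real.norm_eq_abs]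
    exact mul_le_of_le_one_right (abs_nonneg _) (abs_cutoff_le_one le_rfl zero_le_one _ _)
  have hanti : Antitone g := by
    intro u v huv
    refine integral_mono_ae (hint0 v) (hint0 u) ?_
    filter_upwards [hf0] with x hx
    refine mul_le_mul_of_nonneg_left ?_ hx
    rcases le_or_gt (k x) v with h | h
    · rw [cutoff_zero_of_le h]; exact cutoff_nonneg le_rfl _ _
    · rw [cutoff_of_lt _ h, cutoff_of_lt _ (huv.trans_lt h)]
  set S : Set ℝ := {u | lo ≤ u ∧ g u ≤ t} with hS
  have hmem : max lo hi ∈ S := by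
    refine ⟨le_max_left _ _, ?_⟩
    have : g (max lo hi) = 0 := by
      refine integral_eq_zero_of_ae ?_
      filter_upwards [hhi] with x hx
      rcases le_or_gt (k x) (max lo hi) with h | h
      · simp [cutoff_zero_of_le h]
      · simp [hx (lt_of_le_of_lt (le_max_right _ _) h)]
    rw [this]; exact ht0
  have hbdd : BddBelow S := ⟨lo, fun u hu => hu.1⟩
  set y := sInf S with hy
  have hloy : lo ≤ y := le_csInf ⟨_, hmem⟩ fun u hu => hu.1
  have h1 : g y ≤ t := by
    refine le_of_tendsto (hdct (𝓝[>] y) y 0 (tendsto_cutoff_right y 0)) ?_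
    filter_upwards [self_mem_nhdsWithin] with u hu
    obtain ⟨s, hs, hsu⟩ := exists_lt_of_csInf_lt ⟨_, hmem⟩ hu
    exact (hanti hsu.le).trans hs.2
  have h2 : t ≤ g' y := by
    rcases hloy.lt_or_eq with h | h
    · refine ge_of_tendsto (hdct (𝓝[<] y) y 1 (tendsto_cutoff_left y 0)) ?_
      filter_upwards [Ioo_mem_nhdsLT h] with u hu
      by_contra hc
      exact absurd (csInf_le hbdd (show u ∈ S from ⟨hu.1.le, (not_le.1 hc).le⟩)) (not_le.2 hu.2)
    · refine ht.trans_eq (integral_congr_ae ?_)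
      filter_upwards [hlo] with x hx
      rcases lt_or_ge (k x) lo with h' | h'
      · simp [hx h']
      · rw [cutoff_one_of_le (h ▸ h'), mul_one]
  have hseg : t ∈ segment ℝ (g y) (g' y) := by
    rw [segment_eq_Icc (h1.trans h2)]; exact ⟨h1, h2⟩
  obtain ⟨a, θ, ha, hθ, hab, h⟩ := hseg
  refine ⟨y, θ, hloy, hθ, by linarith, ?_⟩
  rw [integral_mul_cutoff_eq_combination hf hk, ← h, show 1 - θ = a by linarith]
  rfl

/-! ### Experiments -/

lemma Environment.exists_bound (Γ : Environment) :
    ∃ B : ℝ, 0 < B ∧ ∀ v : Γ.V, |(v : ℝ)| ≤ B ∧ |Γ.c v| ≤ B := by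
  obtain ⟨B₁, h₁⟩ := (isCompact_range
    (continuous_subtype_val : Continuous fun v : Γ.V => (v : ℝ))).isBounded.exists_norm_le
  obtain ⟨B₂, h₂⟩ := (isCompact_range Γ.continuous_c).isBounded.exists_norm_le
  refine ⟨max (max B₁ B₂) 1, by positivity, fun v => ⟨?_, ?_⟩⟩
  · exact (h₁ _ ⟨v, rfl⟩).trans ((le_max_left _ _).trans (le_max_left _ _))
  · exact (h₂ _ ⟨v, rfl⟩).trans ((le_max_right _ _).trans (le_max_left _ _))

variable {Γ : Environment}

lemma Environment.measurable_c : Measurable Γ.c := Γ.continuous_c.measurable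

lemma integrable_value {X : Type*} [MeasurableSpace X] {ρ : Measure X} [IsFiniteMeasure ρ]
    {f : X → Γ.V} (hf : Measurable f) : Integrable (fun x => (f x : ℝ)) ρ := by
  obtain ⟨B, -, hB⟩ := Γ.exists_bound
  exact Integrable.of_bound (measurable_subtype_coe.comp hf).aestronglyMeasurable B
    (ae_of_all _ fun x => (hB (f x)).1)

lemma integrable_cost {X : Type*} [MeasurableSpace X] {ρ : Measure X} [IsFiniteMeasure ρ]
    {f : X → Γ.V} (hf : Measurable f) : Integrable (fun x => Γ.c (f x)) ρ := by
  obtain ⟨B, -, hB⟩ := Γ.exists_bound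
  exact Integrable.of_bound (Γ.measurable_c.comp hf).aestronglyMeasurable B
    (ae_of_all _ fun x => (hB (f x)).2)

/-- An experiment: the joint law of Buyer's estimate `m` of the value and of the value `v` itself,
with the prior as the law of `v` and `m = E[v | m]`. The conditional expectation is
encoded by test functions; the bound on `m` keeps the integrals meaningful. -/
structure IsExperiment (G : Measure (ℝ × Γ.V)) : Prop where
  isProbabilityMeasure : IsProbabilityMeasure G
  snd_eq : G.snd = Γ.μ
  bounded : ∃ B : ℝ, ∀ᵐ x ∂G, |x.1| ≤ B
  mean : ∀ φ : ℝ → ℝ, Measurable φ → (∀ t, |φ t| ≤ 1) →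
    ∫ x, ((x.2 : ℝ) - x.1) * φ x.1 ∂G = 0

/-- Seller's profit from price `p` when Buyer with estimate `m` accepts with probability `w m`. -/
def profit (G : Measure (ℝ × Γ.V)) (w : ℝ → ℝ) (p : ℝ) : ℝ :=
  ∫ x, (p - Γ.c x.2) * w x.1 ∂G

/-- Buyer's payoff at the price `p`: the expectation of `(m - p)⁺`. -/
def buyerSurplus (G : Measure (ℝ × Γ.V)) (p : ℝ) : ℝ := ∫ x, max (x.1 - p) 0 ∂G

/-- `t` is at least the profit of every price, when an indifferent Buyer rejects. -/
def Caps (G : Measure (ℝ × Γ.V)) (t : ℝ) : Prop := ∀ p, profit G (cutoff p 0) p ≤ t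

variable (Γ) in
/-- The expected gains from trade. -/
def totalSurplus : ℝ := ∫ v : Γ.V, ((v : ℝ) - Γ.c v) ∂Γ.μ

variable {G : Measure (ℝ × Γ.V)}

namespace IsExperiment

lemma integrable_fst (hG : IsExperiment G) : Integrable (fun x => x.1) G := by
  have := hG.isProbabilityMeasure
  obtain ⟨B, hB⟩ := hG.bounded
  exact Integrable.of_bound measurable_fst.aestronglyMeasurable B hB

lemma integrable_price_sub_cost (hG : IsExperiment G) (p : ℝ) :
    Integrable (fun x => p - Γ.c x.2) G := by
  have := hG.isProbabilityMeasure
  exact (integrable_const p).sub (integrable_cost measurable_snd)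

lemma integrable_value_sub_cost (hG : IsExperiment G) :
    Integrable (fun x => (x.2 : ℝ) - Γ.c x.2) G := by
  have := hG.isProbabilityMeasure
  exact (integrable_value measurable_snd).sub (integrable_cost measurable_snd)

lemma integrable_value_sub_fst (hG : IsExperiment G) :
    Integrable (fun x => (x.2 : ℝ) - x.1) G := by
  have := hG.isProbabilityMeasure
  exact (integrable_value measurable_snd).sub hG.integrable_fst

lemma integrable_fst_sub (hG : IsExperiment G) (p : ℝ) : Integrable (fun x => x.1 - p) G := by
  have := hG.isProbabilityMeasure
  exact hG.integrable_fst.sub (integrable_const p)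

lemma integral_value_sub_cost (hG : IsExperiment G) :
    ∫ x, ((x.2 : ℝ) - Γ.c x.2) ∂G = totalSurplus Γ := by
  rw [totalSurplus, ← hG.snd_eq, Measure.snd, integral_map measurable_snd.aemeasurable]
  exact (measurable_subtype_coe.sub Γ.measurable_c).aestronglyMeasurable

/-- The estimate lies within the bounds of the values: otherwise the event that it exceeds them
would violate the martingale property. -/
lemma abs_fst_le (hG : IsExperiment G) {B : ℝ} (hB : ∀ v : Γ.V, |(v : ℝ)| ≤ B) :
    ∀ᵐ x ∂G, |x.1| ≤ B := by
  have key : ∀ s : ℝ, |s| ≤ 1 → ∀ᵐ x ∂G, s * x.1 ≤ B := by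
    intro s hs
    have hw : Measurable (cutoff B 0 ∘ fun m => s * m) :=
      (measurable_cutoff B 0).comp (measurable_const_mul s)
    have h1 := hG.mean _ hw fun t => abs_cutoff_le_one le_rfl zero_le_one _ _
    have hi := integrable_mul_weight hG.integrable_value_sub_fst (hw.comp measurable_fst)
      fun x => abs_cutoff_le_one le_rfl zero_le_one _ _
    have hnn : ∀ x : ℝ × Γ.V, 0 ≤ -s * (((x.2 : ℝ) - x.1) * cutoff B 0 (s * x.1)) := by
      intro x
      rcases le_or_gt (s * x.1) B with h | h
      · simp [cutoff_zero_of_le h]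
      · rw [cutoff_of_lt _ h]
        have : s * x.2 ≤ B := (le_abs_self _).trans (by
          rw [abs_mul]; exact (mul_le_of_le_one_left (abs_nonneg _) hs).trans (hB x.2))
        linarith
    have h2 : ∫ x, -s * (((x.2 : ℝ) - x.1) * cutoff B 0 (s * x.1)) ∂G = 0 := by
      rw [integral_const_mul]
      simp only [Function.comp_apply] at h1
      rw [h1, mul_zero]
    rw [integral_eq_zero_iff_of_nonneg hnn (hi.const_mul (-s))] at h2
    filter_upwards [h2] with x hx
    by_contra hc
    rw [not_le] at hc
    have : s * x.2 ≤ B := (le_abs_self _).trans (by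
      rw [abs_mul]; exact (mul_le_of_le_one_left (abs_nonneg _) hs).trans (hB x.2))
    simp only [cutoff_of_lt _ hc, Pi.zero_apply] at hx
    linarith
  filter_upwards [key 1 (by simp), key (-1) (by simp)] with x h1 h2
  exact abs_le.2 ⟨by linarith, by linarith⟩

/-- Trade with indifferent types never hurts Seller: their expected value is the price, and values
exceed costs. -/
lemma profit_cutoff_zero_le_one (hG : IsExperiment G) (p : ℝ) :
    profit G (cutoff p 0) p ≤ profit G (cutoff p 1) p := by
  set φ : ℝ → ℝ := fun m => cutoff p 1 m - cutoff p 0 m with hφ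
  have hφm : Measurable φ := (measurable_cutoff p 1).sub (measurable_cutoff p 0)
  have hφ01 : ∀ m, φ m = if m = p then 1 else 0 := by
    intro m; simp only [hφ, cutoff]; split_ifs <;> simp_all
  have hφ1 : ∀ m, |φ m| ≤ 1 := by
    intro m; rw [hφ01]; split_ifs <;> simp
  have h1 := hG.mean φ hφm hφ1
  have hi1 : Integrable (fun x => ((x.2 : ℝ) - x.1) * φ x.1) G :=
    integrable_mul_weight hG.integrable_value_sub_fst (hφm.comp measurable_fst) fun x => hφ1 _
  have hi2 : Integrable (fun x => ((x.2 : ℝ) - Γ.c x.2) * φ x.1) G :=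
    integrable_mul_weight hG.integrable_value_sub_cost (hφm.comp measurable_fst) fun x => hφ1 _
  have h2 : 0 ≤ ∫ x, ((x.2 : ℝ) - Γ.c x.2) * φ x.1 ∂G := by
    refine integral_nonneg fun x => mul_nonneg (sub_nonneg.2 (Γ.c_le _)) ?_
    rw [hφ01]; split_ifs <;> simp
  have h3 : profit G (cutoff p 1) p - profit G (cutoff p 0) p =
      ∫ x, ((x.2 : ℝ) - Γ.c x.2) * φ x.1 ∂G - ∫ x, ((x.2 : ℝ) - x.1) * φ x.1 ∂G := by
    simp only [profit]
    rw [← integral_sub, ← integral_sub hi2 hi1]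
    · refine integral_congr_ae (ae_of_all _ fun x => ?_)
      by_cases h : x.1 = p
      · simp only [hφ, h]; ring
      · have := hφ01 x.1
        rw [if_neg h] at this
        simp only [this]
        simp only [hφ] at this
        linear_combination (p - Γ.c x.2) * this
    · exact integrable_mul_cutoff (hG.integrable_price_sub_cost p) measurable_fst zero_le_one
        le_rfl p
    · exact integrable_mul_cutoff (hG.integrable_price_sub_cost p) measurable_fst le_rfl
        zero_le_one p
  linarith

end IsExperiment

namespace Caps

variable {t : ℝ}

/-- Undercutting a price slightly wins the indifferent types, so the cap also holds when they
accept. -/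
lemma profit_cutoff_one_le (hG : IsExperiment G) (h : Caps G t) (p : ℝ) :
    profit G (cutoff p 1) p ≤ t := by
  have := hG.isProbabilityMeasure
  have hlim : Tendsto (fun u => profit G (cutoff u 0) u) (𝓝[<] p)
      (𝓝 (profit G (cutoff p 1) p)) := by
    refine tendsto_integral_filter_of_dominated_convergence
      (fun x => |p - Γ.c x.2| + 1)
      (Eventually.of_forall fun u => (integrable_mul_cutoff (hG.integrable_price_sub_cost u)
        measurable_fst le_rfl zero_le_one u).aestronglyMeasurable) ?_
      ((hG.integrable_price_sub_cost p).abs.add (integrable_const 1)) (ae_of_all _ fun x => ?_)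
    · filter_upwards [Ioo_mem_nhdsLT (sub_one_lt p)] with u hu
      refine ae_of_all _ fun x => ?_
      rw [norm_mul, Real.norm_eq_abs, Real.norm_eq_abs]
      refine (mul_le_of_le_one_right (abs_nonneg _)
        (abs_cutoff_le_one le_rfl zero_le_one _ _)).trans ?_
      have h1 := hu.1
      have h2 := hu.2
      refine abs_le.2 ⟨?_, ?_⟩
      · have := neg_abs_le (p - Γ.c x.2); linarith
      · have := le_abs_self (p - Γ.c x.2); linarith
    · exact ((tendsto_id.mono_left nhdsWithin_le_nhds).sub_const _).mul
        (tendsto_cutoff_left p 0 x.1)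
  exact le_of_tendsto hlim (Eventually.of_forall h)

lemma profit_cutoff_le (hG : IsExperiment G) (h : Caps G t) {θ : ℝ} (h0 : 0 ≤ θ) (h1 : θ ≤ 1)
    (p : ℝ) : profit G (cutoff p θ) p ≤ t := by
  have := integral_mul_cutoff_eq_combination (hG.integrable_price_sub_cost p) measurable_fst p θ
  have e : profit G (cutoff p θ) p =
    (1 - θ) * profit G (cutoff p 0) p + θ * profit G (cutoff p 1) p := this
  rw [e]
  nlinarith [h p, h.profit_cutoff_one_le hG p]

lemma nonneg (hG : IsExperiment G) (h : Caps G t) : 0 ≤ t := by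
  obtain ⟨B, -, hB⟩ := Γ.exists_bound
  refine le_trans (le_of_eq ?_) (h B)
  refine (integral_eq_zero_of_ae ?_).symm
  filter_upwards [hG.abs_fst_le fun v => (hB v).1] with x hx
  simp [cutoff_zero_of_le ((le_abs_self _).trans hx)]

end Caps

/-! ### Pooling estimates -/

/-- The experiment obtained from `G` by sending each estimate `m`, with probability `w m`, to a
common estimate `z`. -/
def pool (G : Measure (ℝ × Γ.V)) (w : ℝ → ℝ) (z : ℝ) : Measure (ℝ × Γ.V) :=
  G.withDensity (fun x => ENNReal.ofReal (1 - w x.1)) +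
    (G.withDensity fun x => ENNReal.ofReal (w x.1)).map fun x => (z, x.2)

section pool

variable {w : ℝ → ℝ} {z : ℝ}

lemma measurable_prodMk_const_snd (z : ℝ) : Measurable fun x : ℝ × Γ.V => (z, x.2) :=
  measurable_const.prodMk measurable_snd

lemma integral_pool (hw : Measurable w) (h0 : ∀ m, 0 ≤ w m) (h1 : ∀ m, w m ≤ 1)
    {f : ℝ × Γ.V → ℝ} (hf : Measurable f) (hi : Integrable f G)
    (hi' : Integrable (fun x => f (z, x.2)) G) :
    ∫ x, f x ∂(pool G w z) = ∫ x, ((1 - w x.1) * f x + w x.1 * f (z, x.2)) ∂G := by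
  have hm1 : Measurable fun x : ℝ × Γ.V => ENNReal.ofReal (1 - w x.1) :=
    (measurable_const.sub (hw.comp measurable_fst)).ennreal_ofReal
  have hm2 : Measurable fun x : ℝ × Γ.V => ENNReal.ofReal (w x.1) :=
    (hw.comp measurable_fst).ennreal_ofReal
  have ht1 : ∀ x : ℝ × Γ.V, (ENNReal.ofReal (1 - w x.1)).toReal = 1 - w x.1 := fun x =>
    ENNReal.toReal_ofReal (sub_nonneg.2 (h1 _))
  have ht2 : ∀ x : ℝ × Γ.V, (ENNReal.ofReal (w x.1)).toReal = w x.1 := fun x =>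
    ENNReal.toReal_ofReal (h0 _)
  have hi1 : Integrable (fun x => (1 - w x.1) * f x) G :=
    hi.bdd_mul (c := 1) (measurable_const.sub (hw.comp measurable_fst)).aestronglyMeasurable
      (ae_of_all _ fun x => abs_le.2 ⟨by linarith [h1 x.1], by linarith [h0 x.1]⟩)
  have hi2 : Integrable (fun x => w x.1 * f (z, x.2)) G :=
    hi'.bdd_mul (c := 1) (hw.comp measurable_fst).aestronglyMeasurable
      (ae_of_all _ fun x => abs_le.2 ⟨by linarith [h0 x.1], h1 x.1⟩)
  rw [pool, integral_add_measure, integral_map (measurable_prodMk_const_snd z).aemeasurable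
    hf.aestronglyMeasurable,
    integral_withDensity_eq_integral_toReal_smul hm1 (ae_of_all _ fun _ => ENNReal.ofReal_lt_top),
    integral_withDensity_eq_integral_toReal_smul hm2 (ae_of_all _ fun _ => ENNReal.ofReal_lt_top)]
  · simp only [ht1, ht2, smul_eq_mul]
    exact (integral_add hi1 hi2).symm
  · rw [integrable_withDensity_iff_integrable_smul' hm1
      (ae_of_all _ fun _ => ENNReal.ofReal_lt_top)]
    simpa only [ht1, smul_eq_mul] using hi1
  · rw [integrable_map_measure hf.aestronglyMeasurable
      (measurable_prodMk_const_snd z).aemeasurable,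
      integrable_withDensity_iff_integrable_smul' hm2 (ae_of_all _ fun _ => ENNReal.ofReal_lt_top)]
    simpa only [ht2, smul_eq_mul, Function.comp_apply] using hi2

lemma snd_pool (hw : Measurable w) (h0 : ∀ m, 0 ≤ w m) (h1 : ∀ m, w m ≤ 1) :
    (pool G w z).snd = G.snd := by
  have hm1 : Measurable fun x : ℝ × Γ.V => ENNReal.ofReal (1 - w x.1) :=
    (measurable_const.sub (hw.comp measurable_fst)).ennreal_ofReal
  rw [pool, Measure.snd, Measure.map_add _ _ measurable_snd,
    Measure.map_map measurable_snd (measurable_prodMk_const_snd z)]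
  change Measure.map Prod.snd _ + Measure.map Prod.snd _ = _
  rw [← Measure.map_add _ _ measurable_snd, ← withDensity_add_left hm1]
  have : ((fun x : ℝ × Γ.V => ENNReal.ofReal (1 - w x.1)) + fun x => ENNReal.ofReal (w x.1)) =
      1 := by
    funext x
    simp [← ENNReal.ofReal_add (sub_nonneg.2 (h1 x.1)) (h0 x.1)]
  rw [this, withDensity_one, Measure.snd]

lemma IsExperiment.pool (hG : IsExperiment G) (hw : Measurable w) (h0 : ∀ m, 0 ≤ w m)
    (h1 : ∀ m, w m ≤ 1) (hz : ∫ x, (x.1 - z) * w x.1 ∂G = 0) :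
    IsExperiment (pool G w z) := by
  have := hG.isProbabilityMeasure
  have hsnd : (BilateralTrade.pool G w z).snd = Γ.μ := by rw [snd_pool hw h0 h1, hG.snd_eq]
  refine ⟨⟨?_⟩, hsnd, ?_, fun φ hφ hφ1 => ?_⟩
  · rw [← Measure.snd_univ, hsnd, measure_univ]
  · obtain ⟨B, hB⟩ := hG.bounded
    refine ⟨max B |z|, ?_⟩
    rw [BilateralTrade.pool, ae_add_measure_iff]
    refine ⟨(withDensity_absolutelyContinuous _ _).ae_le ?_, ?_⟩
    · filter_upwards [hB] with x hx using hx.trans (le_max_left _ _)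
    · rw [ae_map_iff (measurable_prodMk_const_snd z).aemeasurable
        (measurableSet_le measurable_fst.abs measurable_const)]
      exact ae_of_all _ fun x => le_max_right _ _
  · have hw1 : ∀ m, |w m| ≤ 1 := fun m => by rw [abs_of_nonneg (h0 m)]; exact h1 m
    have hval : Integrable (fun x : ℝ × Γ.V => (x.2 : ℝ) - z) G :=
      (integrable_value measurable_snd).sub (integrable_const z)
    have hmφ : Measurable fun x : ℝ × Γ.V => φ x.1 := hφ.comp measurable_fst
    have hmw : Measurable fun x : ℝ × Γ.V => w x.1 := hw.comp measurable_fst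
    have hmf : Measurable fun x : ℝ × Γ.V => ((x.2 : ℝ) - x.1) * φ x.1 :=
      ((measurable_subtype_coe.comp measurable_snd).sub measurable_fst).mul hmφ
    rw [integral_pool hw h0 h1 hmf
      (integrable_mul_weight hG.integrable_value_sub_fst hmφ fun x => hφ1 _)
      (hval.mul_const (φ z))]
    have e : ∀ x : ℝ × Γ.V, (1 - w x.1) * (((x.2 : ℝ) - x.1) * φ x.1) +
        w x.1 * (((x.2 : ℝ) - z) * φ z) = ((x.2 : ℝ) - x.1) * φ x.1 -
        ((x.2 : ℝ) - x.1) * (φ x.1 * w x.1) +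
        φ z * (((x.2 : ℝ) - x.1) * w x.1 + (x.1 - z) * w x.1) := fun x => by ring
    have hφw : ∀ m, |φ m * w m| ≤ 1 := fun m => by
      rw [abs_mul]; exact mul_le_one₀ (hφ1 m) (abs_nonneg _) (hw1 m)
    have i1 := integrable_mul_weight hG.integrable_value_sub_fst hmφ fun x => hφ1 x.1
    have i2 : Integrable (fun x => ((x.2 : ℝ) - x.1) * (φ x.1 * w x.1)) G :=
      integrable_mul_weight hG.integrable_value_sub_fst (hmφ.mul hmw) fun x => hφw x.1
    have i3 := integrable_mul_weight hG.integrable_value_sub_fst hmw fun x => hw1 x.1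
    have i4 := integrable_mul_weight (hG.integrable_fst_sub z) hmw fun x => hw1 x.1
    have i12 : Integrable (fun x => ((x.2 : ℝ) - x.1) * φ x.1 -
      ((x.2 : ℝ) - x.1) * (φ x.1 * w x.1)) G := i1.sub i2
    have i34 : Integrable (fun x => φ z * (((x.2 : ℝ) - x.1) * w x.1 + (x.1 - z) * w x.1)) G :=
      (i3.add i4).const_mul _
    simp only [e]
    rw [integral_add i12 i34, integral_sub i1 i2,
      integral_const_mul, integral_add i3 i4, hG.mean φ hφ hφ1,
      hG.mean (fun m => φ m * w m) (hφ.mul hw) hφw, hG.mean w hw hw1, hz]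
    simp

lemma profit_pool (hG : IsExperiment G) (hw : Measurable w) (h0 : ∀ m, 0 ≤ w m)
    (h1 : ∀ m, w m ≤ 1) (p : ℝ) :
    profit (pool G w z) (cutoff p 1) p =
      profit G (fun m => (1 - w m) * cutoff p 1 m + w m * cutoff p 1 z) p := by
  have hmf : Measurable fun x : ℝ × Γ.V => (p - Γ.c x.2) * cutoff p 1 x.1 :=
    (measurable_const.sub (Γ.measurable_c.comp measurable_snd)).mul
      ((measurable_cutoff p 1).comp measurable_fst)
  rw [profit, integral_pool hw h0 h1 hmf
    (integrable_mul_cutoff (hG.integrable_price_sub_cost p) measurable_fst zero_le_one le_rfl p)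
    ((hG.integrable_price_sub_cost p).mul_const (cutoff p 1 z)), profit]
  exact integral_congr_ae (ae_of_all _ fun x => by simp only; ring)

end pool

lemma profit_eq_sub (hG : IsExperiment G) {w : ℝ → ℝ} (hw : Measurable w) (hw1 : ∀ m, |w m| ≤ 1)
    (p : ℝ) : profit G w p = p * ∫ x, w x.1 ∂G - ∫ x, Γ.c x.2 * w x.1 ∂G := by
  have := hG.isProbabilityMeasure
  have i1 : Integrable (fun x : ℝ × Γ.V => p * w x.1) G :=
    integrable_mul_weight (integrable_const p) (hw.comp measurable_fst) fun x => hw1 x.1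
  have i2 : Integrable (fun x : ℝ × Γ.V => Γ.c x.2 * w x.1) G :=
    integrable_mul_weight (integrable_cost measurable_snd) (hw.comp measurable_fst)
      fun x => hw1 x.1
  rw [profit, ← integral_const_mul, ← integral_sub i1 i2]
  exact integral_congr_ae (ae_of_all _ fun x => by simp only; ring)

/-- From an experiment whose profits are capped by `t`, any payoff pair `(b, s)` with `s ≥ t`,
`b ≥ 0` and `b + s` at most the total surplus results, at a profit-maximising price `z`, from some
experiment. Trade is confined to the estimates selected by a cutoff rule `A` with surplus `b + s`,
and `z` is the price at which trade on `A` earns Seller `s`. A second cutoff rule `C` singles out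
the highest estimates, whose rents above `z` add up to `b`; the rest of `A` is pooled, and then has
mean `z`. The new demand at a price is either the old one, or `A` at prices up to `z`, or `C` at
prices up to its own cutoff, so no price but `z` earns more than `t`, unless it is below `z` and
sells to the same types as `z`. -/
theorem exists_experiment_of_caps {t s b : ℝ} (hG : IsExperiment G) (hcap : Caps G t)
    (hts : t ≤ s) (hb : 0 ≤ b) (hbs : b + s ≤ totalSurplus Γ) :
    ∃ (G' : Measure (ℝ × Γ.V)) (z : ℝ), IsExperiment G' ∧
      (∀ p, profit G' (cutoff p 1) p ≤ s) ∧ profit G' (cutoff z 1) z = s ∧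
      buyerSurplus G' z = b ∧ (t < s → ∀ p, p ≠ z → profit G' (cutoff p 1) p < s) := by
  have := hG.isProbabilityMeasure
  have ht := hcap.nonneg hG
  obtain ⟨B, -, hB⟩ := Γ.exists_bound
  have hbd := hG.abs_fst_le fun v => (hB v).1
  rcases (add_nonneg hb (ht.trans hts)).eq_or_lt with hzero | hpos
  · -- No gains are to be realised: a price above all estimates.
    have hs : s = 0 := by linarith
    have hb' : b = 0 := by linarith
    refine ⟨G, B + 1, hG, fun p => (hcap.profit_cutoff_one_le hG p).trans hts, ?_, ?_,
      fun h => absurd h (by linarith)⟩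
    · rw [hs]
      refine integral_eq_zero_of_ae ?_
      filter_upwards [hbd] with x hx
      have := (le_abs_self _).trans hx
      simp [cutoff_of_gt 1 (show x.1 < B + 1 by linarith)]
    · rw [hb']
      refine integral_eq_zero_of_ae ?_
      filter_upwards [hbd] with x hx
      have := (le_abs_self _).trans hx
      simp only [Pi.zero_apply, max_eq_right_iff]; linarith
  obtain ⟨y, θ, -, hθ0, hθ1, hA⟩ := exists_cutoff_integral_eq (k := Prod.fst)
    hG.integrable_value_sub_cost (ae_of_all _ fun x => sub_nonneg.2 (Γ.c_le _)) measurable_fst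
    (lo := -B) (hi := B)
    (by filter_upwards [hbd] with x hx h using absurd h (not_lt.2 (abs_le.1 hx).1))
    (by filter_upwards [hbd] with x hx h using absurd h (not_lt.2 (abs_le.1 hx).2))
    hpos.le (hbs.trans_eq hG.integral_value_sub_cost.symm)
  set A : ℝ → ℝ := cutoff y θ with hAdef
  have hAm : Measurable A := measurable_cutoff y θ
  have hA0 : ∀ m, 0 ≤ A m := cutoff_nonneg hθ0 y
  have hA1 : ∀ m, A m ≤ 1 := cutoff_le_one hθ1 y
  have hAabs : ∀ m, |A m| ≤ 1 := abs_cutoff_le_one hθ0 hθ1 y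
  have hAm' : Measurable fun x : ℝ × Γ.V => A x.1 := hAm.comp measurable_fst
  have hAint : Integrable (fun x : ℝ × Γ.V => A x.1) G :=
    Integrable.of_bound hAm'.aestronglyMeasurable 1 (ae_of_all _ fun x => hAabs x.1)
  set a : ℝ := ∫ x, A x.1 ∂G with ha
  set d : ℝ := ∫ x, Γ.c x.2 * A x.1 ∂G with hd
  have ha_pos : 0 < a := by
    refine (integral_nonneg fun x : ℝ × Γ.V => hA0 x.1).lt_of_ne fun h => ?_
    have h0 := (integral_eq_zero_iff_of_nonneg (fun x : ℝ × Γ.V => hA0 x.1) hAint).1 h.symm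
    refine hpos.ne' (hA.symm.trans (integral_eq_zero_of_ae ?_))
    filter_upwards [h0] with x hx
    rw [Pi.zero_apply] at hx ⊢
    rw [hx, mul_zero]
  have hprofA : ∀ p, profit G A p = p * a - d := profit_eq_sub hG hAm hAabs
  set z : ℝ := (s + d) / a with hz
  have hza : z * a = s + d := by rw [hz]; field_simp
  have hprofz : profit G A z = s := by rw [hprofA]; linarith
  -- Trade on `A` at price `y` is what demand at `y` yields under some tie-breaking, so it earns at
  -- most `t ≤ s`, and profit from `A` increases in the price.
  have hyz : y ≤ z := by
    have h := (hcap.profit_cutoff_le hG hθ0 hθ1 y).trans hts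
    rw [← hprofz, ← hAdef, hprofA, hprofA] at h
    exact le_of_mul_le_mul_right (by linarith) ha_pos
  -- Gains from trade on `A` are `b + s`, of which Seller gets `s`: Buyer's part is `b`.
  have hmeanA : ∫ x, (x.1 - z) * A x.1 ∂G = b := by
    have i1 := integrable_mul_weight hG.integrable_value_sub_cost hAm' fun x => hAabs x.1
    have i2 := integrable_mul_weight (hG.integrable_price_sub_cost z) hAm' fun x => hAabs x.1
    have i3 := integrable_mul_weight hG.integrable_value_sub_fst hAm' fun x => hAabs x.1
    have e : ∀ x : ℝ × Γ.V, (x.1 - z) * A x.1 = ((x.2 : ℝ) - Γ.c x.2) * A x.1 -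
      (z - Γ.c x.2) * A x.1 - ((x.2 : ℝ) - x.1) * A x.1 := fun x => by ring
    have i12 : Integrable (fun x : ℝ × Γ.V => ((x.2 : ℝ) - Γ.c x.2) * A x.1 -
      (z - Γ.c x.2) * A x.1) G := i1.sub i2
    simp only [e]
    rw [integral_sub i12 i3, integral_sub i1 i2, hG.mean A hAm hAabs]
    rw [profit] at hprofz
    rw [hA, hprofz]; ring
  have hpart : Integrable (fun x : ℝ × Γ.V => max (x.1 - z) 0) G :=
    (hG.integrable_fst_sub z).pos_part
  have hrent : Integrable (fun x : ℝ × Γ.V => max (x.1 - z) 0 * A x.1) G :=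
    integrable_mul_weight hpart hAm' fun x => hAabs x.1
  have hrent_ge : b ≤ ∫ x, max (x.1 - z) 0 * A x.1 ∂G := by
    rw [← hmeanA]
    exact integral_mono (integrable_mul_weight (hG.integrable_fst_sub z) hAm' fun x => hAabs x.1)
      hrent fun x => mul_le_mul_of_nonneg_right (le_max_left _ _) (hA0 _)
  obtain ⟨u, η, hzu, hη0, hη1, hC⟩ := exists_cutoff_integral_eq (k := Prod.fst) hrent
    (ae_of_all _ fun x => mul_nonneg (le_max_right _ _) (hA0 _)) measurable_fst
    (lo := z) (hi := B)
    (ae_of_all _ fun x h => by rw [max_eq_right (by linarith), zero_mul])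
    (by filter_upwards [hbd] with x hx h using absurd h (not_lt.2 (abs_le.1 hx).2))
    hb hrent_ge
  set C : ℝ → ℝ := cutoff u η with hCdef
  have hCm : Measurable C := measurable_cutoff u η
  have hC0 : ∀ m, 0 ≤ C m := cutoff_nonneg hη0 u
  have hC1 : ∀ m, C m ≤ 1 := cutoff_le_one hη1 u
  set w : ℝ → ℝ := fun m => A m * (1 - C m) with hw
  have hwm : Measurable w := hAm.mul (measurable_const.sub hCm)
  have hw0 : ∀ m, 0 ≤ w m := fun m => mul_nonneg (hA0 m) (sub_nonneg.2 (hC1 m))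
  have hw1 : ∀ m, w m ≤ 1 := fun m =>
    mul_le_one₀ (hA1 m) (sub_nonneg.2 (hC1 m)) (by linarith [hC0 m])
  -- The pooled types have mean `z`, since the rents of the types kept by `C` use up all of `b`.
  have hpool : ∫ x, (x.1 - z) * w x.1 ∂G = 0 := by
    have e : ∀ x : ℝ × Γ.V, (x.1 - z) * w x.1 =
        (x.1 - z) * A x.1 - max (x.1 - z) 0 * A x.1 * C x.1 := by
      intro x
      rcases le_or_gt z x.1 with h | h
      · rw [max_eq_left (by linarith)]; simp only [hw]; ring
      · rw [hCdef]; simp only [hw, hCdef, cutoff_of_gt η (h.trans_le hzu)]; ring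
    simp only [e]
    rw [integral_sub (integrable_mul_weight (hG.integrable_fst_sub z) hAm' fun x => hAabs x.1)
      (integrable_mul_cutoff hrent measurable_fst hη0 hη1 u), hmeanA, hC, sub_self]
  have hprof := profit_pool (z := z) hG hwm hw0 hw1
  have hle_y : ∀ p ≤ y, profit (pool G w z) (cutoff p 1) p = profit G (cutoff p 1) p := by
    intro p hp
    rw [hprof p]
    congr 1; funext m
    rw [cutoff_one_of_le (hp.trans hyz)]
    rcases le_or_gt p m with h | h
    · rw [cutoff_one_of_le h]; ring
    · simp only [hw, hAdef, cutoff_of_gt θ (h.trans_le hp), cutoff_of_gt 1 h]; ring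
  have hle_z : ∀ p, y < p → p ≤ z → profit (pool G w z) (cutoff p 1) p = profit G A p := by
    intro p hyp hp
    rw [hprof p]
    congr 1; funext m
    rw [cutoff_one_of_le hp]
    rcases le_or_gt p m with h | h
    · rw [cutoff_one_of_le h, hAdef, cutoff_of_lt θ (hyp.trans_le h)]; ring
    · simp only [hw, hCdef, cutoff_of_gt 1 h, cutoff_of_gt η (h.trans_le (hp.trans hzu))]; ring
  have hgt_z : ∀ p, z < p → profit (pool G w z) (cutoff p 1) p ≤ t := by
    intro p hzp
    rw [hprof p]
    rcases le_or_gt p u with hpu | hpu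
    · have e : (fun m => (1 - w m) * cutoff p 1 m + w m * cutoff p 1 z) = C := by
        funext m
        rw [cutoff_of_gt 1 hzp]
        rcases le_or_gt p m with h | h
        · simp only [hw, hAdef, cutoff_one_of_le h,
            cutoff_of_lt θ (hyz.trans_lt (hzp.trans_le h))]; ring
        · simp only [hCdef, cutoff_of_gt 1 h, cutoff_of_gt η (h.trans_le hpu)]; ring
      rw [e]
      refine le_trans ?_ (hcap.profit_cutoff_le hG hη0 hη1 u)
      have hCabs := abs_cutoff_le_one hη0 hη1 u
      rw [profit_eq_sub hG hCm hCabs, profit_eq_sub hG hCm hCabs]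
      have := mul_le_mul_of_nonneg_right hpu (integral_nonneg fun x : ℝ × Γ.V => hC0 x.1 :
        0 ≤ ∫ x, C x.1 ∂G)
      linarith
    · have e : (fun m => (1 - w m) * cutoff p 1 m + w m * cutoff p 1 z) = cutoff p 1 := by
        funext m
        rw [cutoff_of_gt 1 hzp]
        rcases le_or_gt p m with h | h
        · simp only [hw, hCdef, cutoff_of_lt η (hpu.trans_le h)]; ring
        · rw [cutoff_of_gt 1 h]; ring
      rw [e]
      exact hcap.profit_cutoff_one_le hG p
  have hle : ∀ p, profit (pool G w z) (cutoff p 1) p ≤ s := by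
    intro p
    rcases le_or_gt p y with h1 | h1
    · rw [hle_y p h1]; exact (hcap.profit_cutoff_one_le hG p).trans hts
    rcases le_or_gt p z with h2 | h2
    · rw [hle_z p h1 h2, ← hprofz, hprofA, hprofA]
      linarith [mul_le_mul_of_nonneg_right h2 ha_pos.le]
    · exact (hgt_z p h2).trans hts
  refine ⟨pool G w z, z, hG.pool hwm hw0 hw1 hpool, hle, ?_, ?_, fun hts' p hpz => ?_⟩
  · rcases hyz.lt_or_eq with h | h
    · rw [hle_z z h le_rfl, hprofz]
    · -- If `z` is the cutoff of `A`, serving all indifferent types earns at least as much as `A`.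
      refine le_antisymm (hle z) ?_
      rw [hle_y z h.ge]
      have h1 : profit G A z =
          (1 - θ) * profit G (cutoff z 0) z + θ * profit G (cutoff z 1) z := by
        rw [hAdef, h]
        exact integral_mul_cutoff_eq_combination (hG.integrable_price_sub_cost z)
          measurable_fst z θ
      rw [hprofz] at h1
      nlinarith [hG.profit_cutoff_zero_le_one z]
  · have hmf : Measurable fun x : ℝ × Γ.V => max (x.1 - z) 0 :=
      (measurable_fst.sub measurable_const).max measurable_const
    rw [buyerSurplus, integral_pool hwm hw0 hw1 hmf hpart (by simp), ← hC]
    refine integral_congr_ae (ae_of_all _ fun x => ?_)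
    simp only [sub_self, max_self, mul_zero, add_zero]
    rcases le_or_gt x.1 z with h | h
    · rw [max_eq_right (by linarith)]; ring
    · simp only [hw, hAdef, cutoff_of_lt θ (hyz.trans_lt h)]; ring
  · rcases le_or_gt p y with h1 | h1
    · rw [hle_y p h1]; exact (hcap.profit_cutoff_one_le hG p).trans_lt hts'
    rcases le_or_gt p z with h2 | h2
    · rw [hle_z p h1 h2, ← hprofz, hprofA, hprofA]
      linarith [mul_lt_mul_of_pos_right (h2.lt_of_ne hpz) ha_pos]
    · exact (hgt_z p h2).trans_lt hts'

/-! ### Existence of an experiment with least profit cap -/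

lemma measurable_cutoff_uncurry (θ : ℝ) : Measurable fun q : ℝ × ℝ => cutoff q.1 θ q.2 :=
  Measurable.ite (measurableSet_lt measurable_fst measurable_snd) measurable_const
    (Measurable.ite (measurableSet_eq_fun measurable_snd measurable_fst) measurable_const
      measurable_const)

/-- The piecewise linear approximation of the demand at price `p` that rises from `0` at `p` to `1`
at `p + ε`. -/
def ramp (p ε m : ℝ) : ℝ := max 0 (min 1 ((m - p) / ε))

lemma continuous_ramp (p ε : ℝ) : Continuous (ramp p ε) := by unfold ramp; fun_prop

lemma abs_ramp_le_one (p ε m : ℝ) : |ramp p ε m| ≤ 1 := by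
  rw [ramp, abs_of_nonneg (le_max_left _ _)]
  exact max_le zero_le_one (min_le_left _ _)

lemma tendsto_ramp (p m : ℝ) :
    Tendsto (fun ε => ramp p ε m) (𝓝[>] 0) (𝓝 (cutoff p 0 m)) := by
  refine tendsto_const_nhds.congr' ?_
  rcases le_or_gt m p with h | h
  · filter_upwards [self_mem_nhdsWithin] with ε hε
    have : (m - p) / ε ≤ 0 := div_nonpos_of_nonpos_of_nonneg (by linarith) (le_of_lt hε)
    rw [cutoff_zero_of_le h, ramp, max_eq_left ((min_le_right _ _).trans this)]
  · filter_upwards [Ioo_mem_nhdsGT (sub_pos.2 h)] with ε hε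
    have : 1 ≤ (m - p) / ε := by rw [le_div_iff₀ hε.1]; linarith [hε.2]
    rw [cutoff_of_lt _ h, ramp, min_eq_left this, max_eq_right zero_le_one]

/-- The ramp is the demand averaged over prices between `p` and `p + ε`. -/
lemma integral_cutoff_eq_ramp {p ε m : ℝ} (hε : 0 < ε) :
    ∫ u in Set.Ioc (0 : ℝ) 1, cutoff (p + ε * u) 0 m = ramp p ε m := by
  have e : ∀ u, cutoff (p + ε * u) 0 m = (Set.Iio ((m - p) / ε)).indicator 1 u := by
    intro u
    have h : p + ε * u < m ↔ u < (m - p) / ε := by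
      rw [lt_div_iff₀ hε]; constructor <;> intro h <;> linarith
    by_cases hu : u < (m - p) / ε
    · rw [cutoff_of_lt _ (h.2 hu), Set.indicator_of_mem (Set.mem_Iio.2 hu), Pi.one_apply]
    · rw [cutoff_zero_of_le (not_lt.1 (mt h.1 hu)), Set.indicator_of_notMem (by simpa using hu)]
  simp only [e]
  rw [integral_indicator_one measurableSet_Iio, measureReal_restrict_apply measurableSet_Iio, ramp]
  set r := (m - p) / ε
  rcases le_or_gt r 0 with h | h
  · have : Set.Iio r ∩ Set.Ioc 0 1 = ∅ := by
      ext u; simp only [Set.mem_inter_iff, Set.mem_Iio, Set.mem_Ioc, Set.mem_empty_iff_false,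
        iff_false]
      rintro ⟨h1, h2, -⟩; linarith
    rw [this, max_eq_left ((min_le_right _ _).trans h), measureReal_empty]
  rcases le_or_gt r 1 with h' | h'
  · have : Set.Iio r ∩ Set.Ioc 0 1 = Set.Ioo 0 r := by
      ext u; simp only [Set.mem_inter_iff, Set.mem_Iio, Set.mem_Ioc, Set.mem_Ioo]
      constructor
      · rintro ⟨h1, h2, -⟩; exact ⟨h2, h1⟩
      · rintro ⟨h1, h2⟩; exact ⟨h2, h1, by linarith⟩
    rw [this, min_eq_right h', max_eq_right h.le, Real.volume_real_Ioo_of_le h.le, sub_zero]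
  · have : Set.Iio r ∩ Set.Ioc 0 1 = Set.Ioc 0 1 :=
      Set.inter_eq_right.2 fun u hu => lt_of_le_of_lt hu.2 h'
    rw [this, min_eq_left h'.le, max_eq_right zero_le_one,
      Real.volume_real_Ioc_of_le zero_le_one, sub_zero]

lemma Caps.profit_ramp_le {t : ℝ} (hG : IsExperiment G) (h : Caps G t) (p : ℝ) {ε : ℝ}
    (hε : 0 < ε) : profit G (ramp p ε) p ≤ t := by
  have := hG.isProbabilityMeasure
  set U : Measure ℝ := volume.restrict (Set.Ioc (0 : ℝ) 1) with hU
  have hUp : IsProbabilityMeasure U := ⟨by simp [hU]⟩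
  have hm : Measurable fun q : (ℝ × Γ.V) × ℝ => cutoff (p + ε * q.2) 0 q.1.1 :=
    (measurable_cutoff_uncurry 0).comp
      ((measurable_const.add (measurable_snd.const_mul ε)).prodMk
        (measurable_fst.comp measurable_fst))
  have hprice : Integrable (fun q : (ℝ × Γ.V) × ℝ => p + ε * q.2 - Γ.c q.1.2) (G.prod U) := by
    refine Integrable.sub ((integrable_const p).add (Integrable.const_mul ?_ ε))
      (integrable_cost (measurable_snd.comp measurable_fst))
    refine Integrable.comp_snd (f := fun u : ℝ => u) ?_ G
    exact (continuous_id.integrableOn_Icc (a := 0) (b := 1)).mono_set Set.Ioc_subset_Icc_self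
  have hint : Integrable (fun q : (ℝ × Γ.V) × ℝ =>
      (p + ε * q.2 - Γ.c q.1.2) * cutoff (p + ε * q.2) 0 q.1.1) (G.prod U) :=
    integrable_mul_weight hprice hm fun q => abs_cutoff_le_one le_rfl zero_le_one _ _
  calc profit G (ramp p ε) p
      ≤ ∫ x, ∫ u, (p + ε * u - Γ.c x.2) * cutoff (p + ε * u) 0 x.1 ∂U ∂G := by
        refine integral_mono (integrable_mul_weight (hG.integrable_price_sub_cost p)
          ((continuous_ramp p ε).measurable.comp measurable_fst) fun x => abs_ramp_le_one _ _ _)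
          hint.integral_prod_left fun x => ?_
        have hmx : Measurable fun u : ℝ => cutoff (p + ε * u) 0 x.1 :=
          (measurable_cutoff_uncurry 0).comp
            ((measurable_const.add (measurable_id.const_mul ε)).prodMk measurable_const)
        have hux : Integrable (fun u : ℝ => p + ε * u - Γ.c x.2) U := by
          refine IntegrableOn.mono_set (t := Set.Icc 0 1) ?_ Set.Ioc_subset_Icc_self
          exact Continuous.integrableOn_Icc (by fun_prop)
        simp only
        rw [← integral_cutoff_eq_ramp hε, ← integral_const_mul]
        refine integral_mono_ae
          (integrable_mul_weight (integrable_const _) hmx fun u =>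
            abs_cutoff_le_one le_rfl zero_le_one _ _)
          (integrable_mul_weight hux hmx fun u => abs_cutoff_le_one le_rfl zero_le_one _ _) ?_
        filter_upwards [ae_restrict_mem measurableSet_Ioc] with u hu
        refine mul_le_mul_of_nonneg_right ?_ (cutoff_nonneg le_rfl _ _)
        linarith [mul_pos hε hu.1]
    _ = ∫ u, profit G (cutoff (p + ε * u) 0) (p + ε * u) ∂U := integral_integral_swap hint
    _ ≤ ∫ _, t ∂U := integral_mono hint.integral_prod_right (integrable_const t) fun u => h _
    _ = t := by simp

lemma caps_of_forall_profit_ramp_le {t : ℝ} (hG : IsExperiment G)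
    (h : ∀ p ε, 0 < ε → profit G (ramp p ε) p ≤ t) : Caps G t := by
  intro p
  have hlim : Tendsto (fun ε => profit G (ramp p ε) p) (𝓝[>] 0)
      (𝓝 (profit G (cutoff p 0) p)) := by
    refine tendsto_integral_filter_of_dominated_convergence (fun x => |p - Γ.c x.2|)
      (Eventually.of_forall fun ε => (integrable_mul_weight (hG.integrable_price_sub_cost p)
          ((continuous_ramp p ε).measurable.comp measurable_fst)
          fun x => abs_ramp_le_one _ _ _).aestronglyMeasurable)
      (Eventually.of_forall fun ε => ae_of_all _ fun x => ?_)
      (hG.integrable_price_sub_cost p).abs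
      (ae_of_all _ fun x => (tendsto_ramp p x.1).const_mul _)
    rw [norm_mul, Real.norm_eq_abs, Real.norm_eq_abs]
    exact mul_le_of_le_one_right (abs_nonneg _) (abs_ramp_le_one _ _ _)
  refine le_of_tendsto hlim ?_
  filter_upwards [self_mem_nhdsWithin] with ε hε using h p ε hε

/-- The martingale property need only be tested on bounded continuous functions, as these are dense
in `L¹`. -/
lemma integral_mul_eq_zero_of_continuous {X : Type*} [MeasurableSpace X] {ρ : Measure X}
    [IsFiniteMeasure ρ] {f k : X → ℝ} (hf : Integrable f ρ) {M : ℝ} (hM : ∀ᵐ x ∂ρ, |f x| ≤ M)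
    (hk : Measurable k)
    (h : ∀ φ : BoundedContinuousFunction ℝ ℝ, ∫ x, f x * φ (k x) ∂ρ = 0)
    {φ : ℝ → ℝ} (hφ : Measurable φ) (hφ1 : ∀ t, |φ t| ≤ 1) : ∫ x, f x * φ (k x) ∂ρ = 0 := by
  have hint : Integrable φ (ρ.map k) :=
    Integrable.of_bound hφ.aestronglyMeasurable 1 (ae_of_all _ hφ1)
  have hfφ : Integrable (fun x => f x * φ (k x)) ρ :=
    integrable_mul_weight hf (hφ.comp hk) fun x => hφ1 _
  refine abs_eq_zero.1 (le_antisymm (le_of_forall_pos_le_add fun ε hε => ?_) (abs_nonneg _))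
  obtain ⟨g, hg, -⟩ := hint.exists_boundedContinuous_integral_sub_le
    (show 0 < ε / (|M| + 1) by positivity)
  have hgm : Measurable fun x => g (k x) := g.continuous.measurable.comp hk
  have hgi : Integrable (fun x => g (k x)) ρ :=
    Integrable.of_bound hgm.aestronglyMeasurable ‖g‖ (ae_of_all _ fun x => g.norm_coe_le_norm _)
  have hfg : Integrable (fun x => f x * g (k x)) ρ :=
    hf.mul_bdd (c := ‖g‖) hgm.aestronglyMeasurable (ae_of_all _ fun x => g.norm_coe_le_norm _)
  have hφi : Integrable (fun x => φ (k x)) ρ :=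
    Integrable.of_bound (hφ.comp hk).aestronglyMeasurable 1 (ae_of_all _ fun x => hφ1 _)
  have hmd : Measurable fun t => ‖φ t - g t‖ := (hφ.sub g.continuous.measurable).norm
  rw [integral_map hk.aemeasurable hmd.aestronglyMeasurable] at hg
  calc |∫ x, f x * φ (k x) ∂ρ| = |∫ x, (f x * φ (k x) - f x * g (k x)) ∂ρ| := by
        rw [integral_sub hfφ hfg, h g, sub_zero]
    _ ≤ ∫ x, |f x * φ (k x) - f x * g (k x)| ∂ρ := abs_integral_le_integral_abs
    _ ≤ ∫ x, |M| * ‖φ (k x) - g (k x)‖ ∂ρ := by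
        refine integral_mono_ae (hfφ.sub hfg).abs ((hφi.sub hgi).norm.const_mul _) ?_
        filter_upwards [hM] with x hx
        rw [← mul_sub, abs_mul, Real.norm_eq_abs]
        exact mul_le_mul_of_nonneg_right (hx.trans (le_abs_self M)) (abs_nonneg _)
    _ = |M| * ∫ x, ‖φ (k x) - g (k x)‖ ∂ρ := integral_const_mul _ _
    _ ≤ |M| * (ε / (|M| + 1)) := mul_le_mul_of_nonneg_left hg (abs_nonneg _)
    _ ≤ 0 + ε := by
        rw [zero_add, ← mul_div_assoc, div_le_iff₀ (by positivity)]
        nlinarith [abs_nonneg M]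

lemma isClosed_forall {X : Type*} {α : Sort*} [TopologicalSpace X] {P : α → X → Prop}
    (h : ∀ i, IsClosed {x | P i x}) : IsClosed {x | ∀ i, P i x} := by
  rw [Set.ofPred_forall]; exact isClosed_iInter h

/-- The uninformative experiment caps profits by the total surplus. -/
lemma exists_isExperiment_caps_totalSurplus :
    ∃ G : Measure (ℝ × Γ.V), IsExperiment G ∧ Caps G (totalSurplus Γ) := by
  set e : ℝ := ∫ v : Γ.V, (v : ℝ) ∂Γ.μ with he
  have hv : Integrable (fun v : Γ.V => (v : ℝ)) Γ.μ := integrable_value measurable_id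
  have hmk : Measurable fun v : Γ.V => (e, v) := measurable_const.prodMk measurable_id
  refine ⟨Γ.μ.map fun v => (e, v), ⟨Measure.isProbabilityMeasure_map hmk.aemeasurable, ?_, ?_, ?_⟩,
    fun p => ?_⟩
  · rw [Measure.snd, Measure.map_map measurable_snd hmk]
    exact Measure.map_id
  · refine ⟨|e|, ?_⟩
    rw [ae_map_iff hmk.aemeasurable (measurableSet_le measurable_fst.abs measurable_const)]
    exact ae_of_all _ fun v => le_rfl
  · intro φ hφ _
    have hmf : Measurable fun x : ℝ × Γ.V => ((x.2 : ℝ) - x.1) * φ x.1 :=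
      ((measurable_subtype_coe.comp measurable_snd).sub measurable_fst).mul
        (hφ.comp measurable_fst)
    rw [integral_map hmk.aemeasurable hmf.aestronglyMeasurable]
    simp only
    rw [integral_mul_const, integral_sub hv (integrable_const e)]
    simp [he]
  · have hmf : Measurable fun x : ℝ × Γ.V => (p - Γ.c x.2) * cutoff p 0 x.1 :=
      (measurable_const.sub (Γ.measurable_c.comp measurable_snd)).mul
        ((measurable_cutoff p 0).comp measurable_fst)
    have hc : Integrable (fun v : Γ.V => Γ.c v) Γ.μ := integrable_cost measurable_id
    rw [profit, integral_map hmk.aemeasurable hmf.aestronglyMeasurable]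
    simp only
    rw [integral_mul_const]
    rcases le_or_gt e p with h | h
    · simp only [cutoff_zero_of_le h, mul_zero]
      exact Γ.surplus_pos.le
    · simp only [cutoff_of_lt 0 h, mul_one]
      rw [totalSurplus, integral_sub (integrable_const p) hc,
        integral_sub hv hc]
      simp only [integral_const, probReal_univ, one_smul, ← he]
      linarith

variable (Γ) in
/-- Among the profit caps of experiments, there is a least one. The experiments with estimates in a
fixed compact interval form a compact space for weak convergence, on which being capped by `t` is a
closed condition, jointly in the experiment and in `t`. -/
theorem exists_least_cap : ∃ t₀ : ℝ, (∃ G : Measure (ℝ × Γ.V), IsExperiment G ∧ Caps G t₀) ∧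
    t₀ ≤ totalSurplus Γ ∧
    ∀ (G : Measure (ℝ × Γ.V)) (t : ℝ), IsExperiment G → Caps G t → t₀ ≤ t := by
  obtain ⟨B, hB0, hB⟩ := Γ.exists_bound
  set K : Set ℝ := Set.Icc (-B) B with hK
  have hKle : -B ≤ B := by linarith
  have hcK : CompactSpace K := isCompact_iff_compactSpace.1 isCompact_Icc
  set ι : K × Γ.V → ℝ × Γ.V := fun x => ((x.1 : ℝ), x.2) with hι
  have hιm : Measurable ι := (measurable_subtype_coe.comp measurable_fst).prodMk measurable_snd
  -- The conditions on the law of `(m, v)`, in terms of continuous test functions.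
  let D : Set (ProbabilityMeasure (K × Γ.V) × ℝ) :=
    {q | (∀ f : C(Γ.V, ℝ), ∫ x, f x.2 ∂(q.1 : Measure (K × Γ.V)) = ∫ v, f v ∂Γ.μ) ∧
      (∀ φ : BoundedContinuousFunction ℝ ℝ,
        ∫ x, ((x.2 : ℝ) - x.1) * φ x.1 ∂(q.1 : Measure (K × Γ.V)) = 0) ∧
      ∀ p ε, 0 < ε → ∫ x, (p - Γ.c x.2) * ramp p ε x.1 ∂(q.1 : Measure (K × Γ.V)) ≤ q.2}
  have hcont : ∀ f : K × Γ.V → ℝ, Continuous f →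
      Continuous fun q : ProbabilityMeasure (K × Γ.V) × ℝ =>
        ∫ x, f x ∂(q.1 : Measure (K × Γ.V)) := fun f hf =>
    (ProbabilityMeasure.continuous_integral_continuousMap (⟨f, hf⟩ : C(K × Γ.V, ℝ))).comp
      continuous_fst
  have hcv : Continuous fun x : K × Γ.V => (x.2 : ℝ) := continuous_subtype_val.comp continuous_snd
  have hcm : Continuous fun x : K × Γ.V => (x.1 : ℝ) := continuous_subtype_val.comp continuous_fst
  have hcc : Continuous fun x : K × Γ.V => Γ.c x.2 := Γ.continuous_c.comp continuous_snd
  have hDclosed : IsClosed D := by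
    refine IsClosed.inter (isClosed_forall fun f => ?_) (IsClosed.inter
      (isClosed_forall fun φ => ?_)
      (isClosed_forall fun p => isClosed_forall fun ε => isClosed_forall fun _ => ?_))
    · exact isClosed_eq (hcont _ (f.continuous.comp continuous_snd)) continuous_const
    · exact isClosed_eq (hcont _ ((hcv.sub hcm).mul (φ.continuous.comp hcm))) continuous_const
    · exact isClosed_le (hcont _ ((continuous_const.sub hcc).mul
        ((continuous_ramp p ε).comp hcm))) continuous_snd
  have hmφ : ∀ φ : ℝ → ℝ, Measurable φ →
      Measurable fun x : ℝ × Γ.V => ((x.2 : ℝ) - x.1) * φ x.1 := fun φ hφ =>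
    ((measurable_subtype_coe.comp measurable_snd).sub measurable_fst).mul
      (hφ.comp measurable_fst)
  have hmr : ∀ p ε, Measurable fun x : ℝ × Γ.V => (p - Γ.c x.2) * ramp p ε x.1 := fun p ε =>
    (measurable_const.sub (Γ.measurable_c.comp measurable_snd)).mul
      ((continuous_ramp p ε).measurable.comp measurable_fst)
  have hto : ∀ q ∈ D, IsExperiment ((q.1 : Measure (K × Γ.V)).map ι) ∧
      Caps ((q.1 : Measure (K × Γ.V)).map ι) q.2 := by
    rintro ⟨Q, t⟩ ⟨h1, h2, h3⟩
    have hQ : IsProbabilityMeasure ((Q : Measure (K × Γ.V)).map ι) :=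
      Measure.isProbabilityMeasure_map hιm.aemeasurable
    have hexp : IsExperiment ((Q : Measure (K × Γ.V)).map ι) := by
      refine ⟨hQ, ?_, ⟨B, ?_⟩, fun φ hφ hφ1 => ?_⟩
      · refine ext_of_forall_integral_eq_of_IsFiniteMeasure fun f => ?_
        rw [Measure.snd, Measure.map_map measurable_snd hιm,
          integral_map (measurable_snd.comp hιm).aemeasurable
            f.continuous.measurable.aestronglyMeasurable]
        exact h1 f.toContinuousMap
      · rw [ae_map_iff hιm.aemeasurable (measurableSet_le measurable_fst.abs measurable_const)]
        exact ae_of_all _ fun x => abs_le.2 x.1.2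
      · rw [integral_map hιm.aemeasurable (hmφ φ hφ).aestronglyMeasurable]
        have hb : ∀ x : K × Γ.V, |(x.2 : ℝ) - x.1| ≤ B + B := fun x =>
          (abs_sub _ _).trans (add_le_add (hB x.2).1 (abs_le.2 x.1.2))
        exact integral_mul_eq_zero_of_continuous
          (Integrable.of_bound (hcv.sub hcm).measurable.aestronglyMeasurable _ (ae_of_all _ hb))
          (ae_of_all _ hb) hcm.measurable h2 hφ hφ1
    refine ⟨hexp, caps_of_forall_profit_ramp_le hexp fun p ε hε => ?_⟩
    rw [profit, integral_map hιm.aemeasurable (hmr p ε).aestronglyMeasurable]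
    exact h3 p ε hε
  have hfrom : ∀ (G : Measure (ℝ × Γ.V)) (t : ℝ), IsExperiment G → Caps G t →
      ∃ Q, (Q, t) ∈ D := by
    intro G t hG hcap
    have := hG.isProbabilityMeasure
    set κ : ℝ × Γ.V → K × Γ.V := fun x => (Set.projIcc (-B) B hKle x.1, x.2) with hκ
    have hκm : Measurable κ :=
      (continuous_projIcc.measurable.comp measurable_fst).prodMk measurable_snd
    have hid : ∀ᵐ x ∂G, ((κ x).1 : ℝ) = x.1 := by
      filter_upwards [hG.abs_fst_le fun v => (hB v).1] with x hx
      exact congrArg Subtype.val (Set.projIcc_of_mem hKle (abs_le.1 hx))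
    have hint : ∀ f : K × Γ.V → ℝ, Continuous f → ∫ x, f x ∂(G.map κ) = ∫ x, f (κ x) ∂G :=
      fun f hf => integral_map hκm.aemeasurable hf.measurable.aestronglyMeasurable
    refine ⟨⟨G.map κ, Measure.isProbabilityMeasure_map hκm.aemeasurable⟩, fun f => ?_, fun φ => ?_,
      fun p ε hε => ?_⟩
    · refine (hint _ (f.continuous.comp continuous_snd)).trans ?_
      rw [← hG.snd_eq, Measure.snd, integral_map measurable_snd.aemeasurable
        f.continuous.measurable.aestronglyMeasurable]
      rfl
    · refine (hint _ ((hcv.sub hcm).mul (φ.continuous.comp hcm))).trans ?_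
      -- Test functions are normalised to have absolute value at most one.
      have h := hG.mean (fun m => (‖φ‖ + 1)⁻¹ * φ m) (φ.continuous.measurable.const_mul _)
        fun m => by
          rw [abs_mul, abs_of_pos (by positivity), inv_mul_le_iff₀ (by positivity), mul_one]
          exact (φ.norm_coe_le_norm m).trans (by linarith)
      have h' : (‖φ‖ + 1)⁻¹ * ∫ x, ((x.2 : ℝ) - x.1) * φ x.1 ∂G = 0 := by
        rw [← h, ← integral_const_mul]
        exact integral_congr_ae (ae_of_all _ fun x => by simp only; ring)
      rw [← (mul_eq_zero.1 h').resolve_left (by positivity)]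
      refine integral_congr_ae ?_
      filter_upwards [hid] with x hx
      change ((x.2 : ℝ) - (κ x).1) * φ (κ x).1 = _
      rw [hx]
    · refine (hint _ ((continuous_const.sub hcc).mul
        ((continuous_ramp p ε).comp hcm))).trans_le (le_trans (le_of_eq ?_)
        (hcap.profit_ramp_le hG p hε))
      refine integral_congr_ae ?_
      filter_upwards [hid] with x hx
      change (p - Γ.c x.2) * ramp p ε (κ x).1 = _
      rw [hx]
  have hcomp : IsCompact (Prod.snd '' (D ∩ Set.univ ×ˢ Set.Icc 0 (totalSurplus Γ))) :=
    (((isCompact_univ.prod isCompact_Icc).inter_left hDclosed)).image continuous_snd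
  have hne : (Prod.snd '' (D ∩ Set.univ ×ˢ Set.Icc 0 (totalSurplus Γ))).Nonempty := by
    obtain ⟨G, hG, hcap⟩ := exists_isExperiment_caps_totalSurplus (Γ := Γ)
    obtain ⟨Q, hQ⟩ := hfrom G _ hG hcap
    exact ⟨_, _, ⟨hQ, Set.mem_univ _, Γ.surplus_pos.le, le_rfl⟩, rfl⟩
  obtain ⟨t₀, ⟨q, ⟨hq, -, hqS⟩, rfl⟩, hleast⟩ := hcomp.exists_isLeast hne
  refine ⟨q.2, ⟨_, hto q hq⟩, hqS.2, fun G t hG hcap => ?_⟩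
  rcases le_or_gt t (totalSurplus Γ) with h | h
  · obtain ⟨Q, hQ⟩ := hfrom G t hG hcap
    exact hleast ⟨_, ⟨hQ, Set.mem_univ _, hcap.nonneg hG, h⟩, rfl⟩
  · exact hqS.2.trans h.le

/-! ### Payoffs at a fixed price -/

variable {τ : InfoStructure Γ}

instance (σ : SellerStrategy τ) : IsMarkovKernel σ.priceKernel :=
  inferInstanceAs (IsMarkovKernel σ.law.condKernel)

instance (σ : SellerStrategy τ) : IsProbabilityMeasure (outcome τ σ) :=
  inferInstanceAs (IsProbabilityMeasure (τ.P ⊗ₘ (σ.priceKernel.comap Prod.fst measurable_fst)))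

lemma measurable_signal : Measurable fun x : τ.Ts × τ.Tb × Γ.V => x.2.1 :=
  measurable_fst.comp measurable_snd

lemma measurable_value : Measurable fun x : τ.Ts × τ.Tb × Γ.V => x.2.2 :=
  measurable_snd.comp measurable_snd

lemma fst_outcome (σ : SellerStrategy τ) : (outcome τ σ).fst = τ.P :=
  Measure.fst_compProd _ _

lemma measurable_accept (α : BuyerStrategy τ) :
    Measurable fun x : (τ.Ts × τ.Tb × Γ.V) × ℝ => α.prob (x.2, x.1.2.1) :=
  α.measurable_prob.comp (measurable_snd.prodMk (measurable_signal.comp measurable_fst))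

lemma measurable_accept_price (α : BuyerStrategy τ) (p : ℝ) :
    Measurable fun t : τ.Tb => α.prob (p, t) :=
  α.measurable_prob.comp (measurable_const.prodMk measurable_id)

lemma abs_prob_le_one (α : BuyerStrategy τ) (x : ℝ × τ.Tb) : |α.prob x| ≤ 1 :=
  abs_le.2 ⟨by linarith [(α.prob_mem x).1], (α.prob_mem x).2⟩

lemma measurable_buyerGain (α : BuyerStrategy τ) : Measurable (buyerGain α) :=
  ((measurable_subtype_coe.comp (measurable_value.comp measurable_fst)).sub measurable_snd).mul
    (measurable_accept α)

lemma measurable_sellerGain (α : BuyerStrategy τ) : Measurable (sellerGain α) :=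
  (measurable_snd.sub (Γ.measurable_c.comp (measurable_value.comp measurable_fst))).mul
    (measurable_accept α)

/-- Seller's expected payoff from the price `p`. -/
def sellerPayoffAt (α : BuyerStrategy τ) (p : ℝ) : ℝ := ∫ x, sellerGain α (x, p) ∂τ.P

/-- Buyer's expected payoff when the price is `p`. -/
def buyerPayoffAt (α : BuyerStrategy τ) (p : ℝ) : ℝ := ∫ x, buyerGain α (x, p) ∂τ.P

variable (τ) in
/-- Seller's strategy of posting `p` whatever her signal. -/
def constPrice (p : ℝ) : SellerStrategy τ where
  law := τ.P.fst.prod (Measure.dirac p)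
  isProbabilityMeasure_law := inferInstance
  fst_law := Measure.fst_prod

lemma outcome_constPrice (p : ℝ) :
    outcome τ (constPrice τ p) = τ.P.map fun x => (x, p) := by
  have h := eq_condKernel_of_measure_eq_compProd (ρ := (constPrice τ p).law)
    (Kernel.const τ.Ts (Measure.dirac p)) (by
      rw [(constPrice τ p).fst_law, Measure.compProd_const]; rfl)
  rw [(constPrice τ p).fst_law] at h
  have h' : ∀ᵐ x ∂τ.P, (constPrice τ p).priceKernel x.1 = Measure.dirac p := by
    filter_upwards [ae_of_ae_map measurable_fst.aemeasurable h] with x hx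
    exact hx.symm
  have hfst : Measurable (Prod.fst : τ.Ts × τ.Tb × Γ.V → τ.Ts) := measurable_fst
  have e : (constPrice τ p).priceKernel.comap Prod.fst hfst =ᵐ[τ.P]
      Kernel.const _ (Measure.dirac p) := h'
  rw [outcome, Measure.compProd_congr e, Measure.compProd_const, Measure.prod_dirac]

lemma payoffsDefined_constPrice (p : ℝ) (α : BuyerStrategy τ) :
    PayoffsDefined (constPrice τ p) α := by
  have hmk : Measurable fun x : τ.Ts × τ.Tb × Γ.V => (x, p) := measurable_prodMk_right
  have hα : Measurable fun x : τ.Ts × τ.Tb × Γ.V => α.prob (p, x.2.1) :=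
    (measurable_accept_price α p).comp measurable_signal
  rw [PayoffsDefined, outcome_constPrice,
    integrable_map_measure (measurable_buyerGain α).aestronglyMeasurable hmk.aemeasurable,
    integrable_map_measure (measurable_sellerGain α).aestronglyMeasurable hmk.aemeasurable]
  exact ⟨integrable_mul_weight ((integrable_value measurable_value).sub (integrable_const p)) hα
      fun x => abs_prob_le_one _ _,
    integrable_mul_weight ((integrable_const p).sub (integrable_cost measurable_value)) hα
      fun x => abs_prob_le_one _ _⟩

lemma sellerPayoff_constPrice (p : ℝ) (α : BuyerStrategy τ) :
    sellerPayoff (constPrice τ p) α = sellerPayoffAt α p := by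
  rw [sellerPayoff, outcome_constPrice, integral_map measurable_prodMk_right.aemeasurable
    (measurable_sellerGain α).aestronglyMeasurable, sellerPayoffAt]

lemma buyerPayoff_constPrice (p : ℝ) (α : BuyerStrategy τ) :
    buyerPayoff (constPrice τ p) α = buyerPayoffAt α p := by
  rw [buyerPayoff, outcome_constPrice, integral_map measurable_prodMk_right.aemeasurable
    (measurable_buyerGain α).aestronglyMeasurable, buyerPayoffAt]

/-- An uninformed Seller's strategy amounts to a price distribution independent of the state. -/
lemma exists_outcome_eq_prod (hτ : UninformedSeller τ) (σ : SellerStrategy τ) :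
    ∃ q : Measure ℝ, IsProbabilityMeasure q ∧ outcome τ σ = τ.P.prod q := by
  obtain ⟨x⟩ := nonempty_of_isProbabilityMeasure τ.P
  have := hτ
  refine ⟨σ.priceKernel x.1, inferInstance, ?_⟩
  rw [outcome, ← Measure.compProd_const]
  congr 1
  ext1 y
  rw [Kernel.comap_apply, Kernel.const_apply, @Subsingleton.elim _ hτ y.1 x.1]

/-! ### Welfare bounds -/

/-- In every equilibrium, Buyer's payoff is nonnegative: conditional on `(p, t_b)` he accepts only
prices that are at most his expected value. -/
lemma IsWPBE.buyerPayoff_nonneg {σ : SellerStrategy τ} {α : BuyerStrategy τ}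
    {ν : Kernel (ℝ × τ.Tb) Γ.V} (h : IsWPBE σ α ν) : 0 ≤ buyerPayoff σ α := by
  have := h.isMarkovKernel
  set L := (outcome τ σ).map fun x => (x.2, x.1.2.1) with hL
  have hm : Measurable fun x : (τ.Ts × τ.Tb × Γ.V) × ℝ => ((x.2, x.1.2.1), x.1.2.2) :=
    (measurable_snd.prodMk (measurable_signal.comp measurable_fst)).prodMk
      (measurable_value.comp measurable_fst)
  have hLp : IsProbabilityMeasure L := Measure.isProbabilityMeasure_map
    (measurable_snd.prodMk (measurable_signal.comp measurable_fst)).aemeasurable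
  set f : (ℝ × τ.Tb) × Γ.V → ℝ := fun y => ((y.2 : ℝ) - y.1.1) * α.prob y.1 with hf
  have hfm : Measurable f :=
    ((measurable_subtype_coe.comp measurable_snd).sub (measurable_fst.comp measurable_fst)).mul
      (α.measurable_prob.comp measurable_fst)
  have e : buyerPayoff σ α = ∫ y, f y ∂(L ⊗ₘ ν) := by
    rw [h.bayes, integral_map hm.aemeasurable hfm.aestronglyMeasurable]; rfl
  have hfi : Integrable f (L ⊗ₘ ν) := by
    rw [h.bayes, integrable_map_measure hfm.aestronglyMeasurable hm.aemeasurable]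
    exact h.payoffsDefined.1
  rw [e, Measure.integral_compProd hfi]
  refine integral_nonneg fun y => ?_
  obtain ⟨p, t⟩ := y
  have hv : Integrable (fun v : Γ.V => (v : ℝ)) (ν (p, t)) := integrable_value measurable_id
  simp only [hf]
  rw [integral_mul_const, integral_sub hv (integrable_const p)]
  simp only [integral_const, probReal_univ, one_smul]
  rcases le_or_gt p (∫ v : Γ.V, (v : ℝ) ∂(ν (p, t))) with h' | h'
  · exact mul_nonneg (sub_nonneg.2 h') (α.prob_mem _).1
  · rw [(h.buyer_opt p t).2 h', mul_zero]; exact le_rfl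

/-- Payoffs add up to the realised part of the total surplus. -/
lemma PayoffsDefined.add_le {σ : SellerStrategy τ} {α : BuyerStrategy τ}
    (h : PayoffsDefined σ α) : buyerPayoff σ α + sellerPayoff σ α ≤ totalSurplus Γ := by
  have hv : Measurable fun x : (τ.Ts × τ.Tb × Γ.V) × ℝ => x.1.2.2 :=
    measurable_value.comp measurable_fst
  have hms : Measurable fun v : Γ.V => (v : ℝ) - Γ.c v :=
    measurable_subtype_coe.sub Γ.measurable_c
  have hmap : (outcome τ σ).map (fun x => x.1.2.2) = Γ.μ := by
    rw [← τ.marginal_value, ← fst_outcome σ, Measure.fst,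
      Measure.map_map measurable_value measurable_fst]
    rfl
  rw [buyerPayoff, sellerPayoff, ← integral_add h.1 h.2, totalSurplus, ← hmap,
    integral_map hv.aemeasurable hms.aestronglyMeasurable]
  refine integral_mono (h.1.add h.2) ((integrable_value hv).sub (integrable_cost hv)) fun x => ?_
  simp only [buyerGain, sellerGain]
  have h1 := Γ.c_le x.1.2.2
  have h2 := (α.prob_mem (x.2, x.1.2.1)).2
  nlinarith

/-! ### Posterior means -/

/-- `m` is a version of the conditional expectation of the value given Buyer's signal, as tested on
bounded functions of the signal. -/
structure IsPosteriorMean (τ : InfoStructure Γ) (m : τ.Tb → ℝ) : Prop where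
  measurable : Measurable m
  bounded : ∃ B : ℝ, ∀ᵐ x ∂τ.P, |m x.2.1| ≤ B
  mean : ∀ ψ : τ.Tb → ℝ, Measurable ψ → (∀ t, |ψ t| ≤ 1) →
    ∫ x, ((x.2.2 : ℝ) - m x.2.1) * ψ x.2.1 ∂τ.P = 0

/-- The joint law of Buyer's estimate `m t_b` and the value. -/
def estimateLaw (τ : InfoStructure Γ) (m : τ.Tb → ℝ) : Measure (ℝ × Γ.V) :=
  τ.P.map fun x => (m x.2.1, x.2.2)

/-- The means of a disintegration kernel are posterior means. -/
lemma isPosteriorMean_of_compProd_eq {κ : Kernel τ.Tb Γ.V} [IsMarkovKernel κ]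
    (hκ : τ.P.snd.fst ⊗ₘ κ = τ.P.snd) : IsPosteriorMean τ fun t => ∫ v : Γ.V, (v : ℝ) ∂(κ t) := by
  obtain ⟨B, -, hB⟩ := Γ.exists_bound
  have hb : ∀ t, |∫ v : Γ.V, (v : ℝ) ∂(κ t)| ≤ B := fun t => by
    have := norm_integral_le_of_norm_le_const (μ := κ t) (f := fun v : Γ.V => (v : ℝ))
      (ae_of_all _ fun v => (hB v).1)
    simpa using this
  have hm : Measurable fun t => ∫ v : Γ.V, (v : ℝ) ∂(κ t) :=
    (StronglyMeasurable.integral_kernel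
      (measurable_subtype_coe : Measurable fun v : Γ.V => (v : ℝ)).stronglyMeasurable).measurable
  refine ⟨hm, ⟨B, ae_of_all _ fun x => hb _⟩, fun ψ hψ hψ1 => ?_⟩
  set f : τ.Tb × Γ.V → ℝ := fun y => ((y.2 : ℝ) - ∫ v : Γ.V, (v : ℝ) ∂(κ y.1)) * ψ y.1 with hf
  have hfm : Measurable f :=
    ((measurable_subtype_coe.comp measurable_snd).sub (hm.comp measurable_fst)).mul
      (hψ.comp measurable_fst)
  have hfi : Integrable f (τ.P.snd.fst ⊗ₘ κ) := by
    refine integrable_mul_weight ((integrable_value measurable_snd).sub ?_)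
      (hψ.comp measurable_fst) fun x => hψ1 _
    exact Integrable.of_bound (hm.comp measurable_fst).aestronglyMeasurable B
      (ae_of_all _ fun x => hb _)
  have e : ∫ x, ((x.2.2 : ℝ) - ∫ v : Γ.V, (v : ℝ) ∂(κ x.2.1)) * ψ x.2.1 ∂τ.P =
      ∫ y, f y ∂τ.P.snd :=
    (integral_map measurable_snd.aemeasurable hfm.aestronglyMeasurable).symm
  rw [e, ← hκ, Measure.integral_compProd hfi]
  refine integral_eq_zero_of_ae (ae_of_all _ fun t => ?_)
  have hv : Integrable (fun v : Γ.V => (v : ℝ)) (κ t) := integrable_value measurable_id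
  simp only [hf]
  rw [integral_mul_const, integral_sub hv (integrable_const _)]
  simp

namespace IsPosteriorMean

variable {m : τ.Tb → ℝ}

lemma measurable_comp (hm : IsPosteriorMean τ m) :
    Measurable fun x : τ.Ts × τ.Tb × Γ.V => m x.2.1 := hm.measurable.comp measurable_signal

lemma integrable (hm : IsPosteriorMean τ m) : Integrable (fun x => m x.2.1) τ.P := by
  obtain ⟨B, hB⟩ := hm.bounded
  exact Integrable.of_bound hm.measurable_comp.aestronglyMeasurable B hB

lemma integrable_value_sub (hm : IsPosteriorMean τ m) :
    Integrable (fun x => (x.2.2 : ℝ) - m x.2.1) τ.P :=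
  (integrable_value measurable_value).sub hm.integrable

lemma ae_eq {m' : τ.Tb → ℝ} (hm : IsPosteriorMean τ m) (hm' : IsPosteriorMean τ m') :
    ∀ᵐ x ∂τ.P, m x.2.1 = m' x.2.1 := by
  classical
  -- Testing both on the sign of `m - m'` gives the expectation of `|m - m'|`.
  set ψ : τ.Tb → ℝ := fun t => if m' t ≤ m t then 1 else -1 with hψ
  have hψm : Measurable ψ :=
    Measurable.ite (measurableSet_le hm'.measurable hm.measurable) measurable_const
      measurable_const
  have hψ1 : ∀ t, |ψ t| ≤ 1 := fun t => by simp only [hψ]; split_ifs <;> simp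
  have hψc := hψm.comp (measurable_signal (τ := τ))
  have i := integrable_mul_weight hm.integrable_value_sub hψc fun x => hψ1 _
  have i' := integrable_mul_weight hm'.integrable_value_sub hψc fun x => hψ1 _
  have habs : ∀ x : τ.Ts × τ.Tb × Γ.V, |m x.2.1 - m' x.2.1| =
      ((x.2.2 : ℝ) - m' x.2.1) * ψ x.2.1 - ((x.2.2 : ℝ) - m x.2.1) * ψ x.2.1 := by
    intro x
    simp only [hψ]
    split_ifs with h
    · rw [abs_of_nonneg (by linarith)]; ring
    · rw [abs_of_nonpos (by linarith)]; ring
  have h0 : ∫ x, |m x.2.1 - m' x.2.1| ∂τ.P = 0 := by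
    simp only [habs]
    refine (integral_sub i' i).trans ?_
    exact (congrArg₂ _ (hm'.mean ψ hψm hψ1) (hm.mean ψ hψm hψ1)).trans (sub_self 0)
  have hi : Integrable (fun x => |m x.2.1 - m' x.2.1|) τ.P :=
    (hm.integrable.sub hm'.integrable).abs
  filter_upwards [(integral_eq_zero_iff_of_nonneg (fun x => abs_nonneg _) hi).1 h0] with x hx
  exact sub_eq_zero.1 (abs_eq_zero.1 hx)

lemma measurable_pair (hm : IsPosteriorMean τ m) :
    Measurable fun x : τ.Ts × τ.Tb × Γ.V => (m x.2.1, x.2.2) :=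
  hm.measurable_comp.prodMk measurable_value

lemma isExperiment (hm : IsPosteriorMean τ m) : IsExperiment (estimateLaw τ m) := by
  refine ⟨Measure.isProbabilityMeasure_map hm.measurable_pair.aemeasurable, ?_, ?_,
    fun φ hφ hφ1 => ?_⟩
  · rw [estimateLaw, Measure.snd, Measure.map_map measurable_snd hm.measurable_pair]
    exact τ.marginal_value
  · obtain ⟨B, hB⟩ := hm.bounded
    refine ⟨B, ?_⟩
    rwa [estimateLaw, ae_map_iff hm.measurable_pair.aemeasurable
      (measurableSet_le measurable_fst.abs measurable_const)]
  · have hmf : Measurable fun x : ℝ × Γ.V => ((x.2 : ℝ) - x.1) * φ x.1 :=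
      ((measurable_subtype_coe.comp measurable_snd).sub measurable_fst).mul
        (hφ.comp measurable_fst)
    rw [estimateLaw, integral_map hm.measurable_pair.aemeasurable hmf.aestronglyMeasurable]
    exact hm.mean (φ ∘ m) (hφ.comp hm.measurable) fun t => hφ1 _

lemma profit_estimateLaw (hm : IsPosteriorMean τ m) {w : ℝ → ℝ} (hw : Measurable w) (p : ℝ) :
    profit (estimateLaw τ m) w p = ∫ x, (p - Γ.c x.2.2) * w (m x.2.1) ∂τ.P := by
  have hmf : Measurable fun x : ℝ × Γ.V => (p - Γ.c x.2) * w x.1 :=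
    (measurable_const.sub (Γ.measurable_c.comp measurable_snd)).mul (hw.comp measurable_fst)
  rw [profit, estimateLaw, integral_map hm.measurable_pair.aemeasurable hmf.aestronglyMeasurable]

lemma buyerSurplus_estimateLaw (hm : IsPosteriorMean τ m) (p : ℝ) :
    buyerSurplus (estimateLaw τ m) p = ∫ x, max (m x.2.1 - p) 0 ∂τ.P := by
  have hmf : Measurable fun x : ℝ × Γ.V => max (x.1 - p) 0 :=
    (measurable_fst.sub measurable_const).max measurable_const
  rw [buyerSurplus, estimateLaw,
    integral_map hm.measurable_pair.aemeasurable hmf.aestronglyMeasurable]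

lemma integrable_price_sub_cost (p : ℝ) :
    Integrable (fun x : τ.Ts × τ.Tb × Γ.V => p - Γ.c x.2.2) τ.P :=
  (integrable_const p).sub (integrable_cost measurable_value)

/-- Trade with indifferent signals never hurts Seller. -/
lemma integral_indifferent_nonneg (hm : IsPosteriorMean τ m) {p : ℝ} {ψ : τ.Tb → ℝ}
    (hψ : Measurable ψ) (hψ1 : ∀ t, |ψ t| ≤ 1) (hψ0 : ∀ᵐ x ∂τ.P, 0 ≤ ψ x.2.1)
    (hψp : ∀ᵐ x ∂τ.P, m x.2.1 ≠ p → ψ x.2.1 = 0) :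
    0 ≤ ∫ x, (p - Γ.c x.2.2) * ψ x.2.1 ∂τ.P := by
  have hψc : Measurable fun x : τ.Ts × τ.Tb × Γ.V => ψ x.2.1 := hψ.comp measurable_signal
  have hvc : Integrable (fun x : τ.Ts × τ.Tb × Γ.V => (x.2.2 : ℝ) - Γ.c x.2.2) τ.P :=
    (integrable_value measurable_value).sub (integrable_cost measurable_value)
  have i1 := integrable_mul_weight hvc hψc fun x => hψ1 _
  have i2 := integrable_mul_weight hm.integrable_value_sub hψc fun x => hψ1 _
  have e : ∫ x, (p - Γ.c x.2.2) * ψ x.2.1 ∂τ.P =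
      ∫ x, (((x.2.2 : ℝ) - Γ.c x.2.2) * ψ x.2.1 - ((x.2.2 : ℝ) - m x.2.1) * ψ x.2.1) ∂τ.P := by
    refine integral_congr_ae ?_
    filter_upwards [hψp] with x hx
    by_cases h : m x.2.1 = p
    · rw [h]; ring
    · rw [hx h]; ring
  rw [e, integral_sub i1 i2, hm.mean ψ hψ hψ1, sub_zero]
  refine integral_nonneg_of_ae ?_
  filter_upwards [hψ0] with x hx
  exact mul_nonneg (sub_nonneg.2 (Γ.c_le _)) hx

variable {a : τ.Tb → ℝ} {p : ℝ}

lemma profit_le_integral_accept (hm : IsPosteriorMean τ m) (ha : Measurable a)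
    (ha0 : ∀ t, 0 ≤ a t) (ha1 : ∀ t, a t ≤ 1)
    (hopt : ∀ᵐ x ∂τ.P, (p < m x.2.1 → a x.2.1 = 1) ∧ (m x.2.1 < p → a x.2.1 = 0)) :
    profit (estimateLaw τ m) (cutoff p 0) p ≤ ∫ x, (p - Γ.c x.2.2) * a x.2.1 ∂τ.P := by
  have hcut : Measurable fun t => cutoff p 0 (m t) := (measurable_cutoff p 0).comp hm.measurable
  have h := hm.integral_indifferent_nonneg (p := p) (ψ := fun t => a t - cutoff p 0 (m t))
    (ha.sub hcut)
    (fun t => abs_le.2 ⟨by linarith [ha0 t, cutoff_le_one zero_le_one p (m t)],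
      by linarith [ha1 t, cutoff_nonneg le_rfl p (m t)]⟩) ?_ ?_
  · have i1 : Integrable (fun x => (p - Γ.c x.2.2) * a x.2.1) τ.P :=
      integrable_mul_weight (integrable_price_sub_cost p) (ha.comp measurable_signal) fun x =>
        abs_le.2 ⟨by linarith [ha0 x.2.1], ha1 x.2.1⟩
    have i2 : Integrable (fun x => (p - Γ.c x.2.2) * cutoff p 0 (m x.2.1)) τ.P :=
      integrable_mul_cutoff (integrable_price_sub_cost p) hm.measurable_comp le_rfl zero_le_one p
    simp only [mul_sub] at h
    rw [integral_sub i1 i2] at h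
    rw [hm.profit_estimateLaw (measurable_cutoff p 0)]
    linarith
  · filter_upwards [hopt] with x hx
    rcases le_or_gt (m x.2.1) p with h | h
    · simpa only [cutoff_zero_of_le h, sub_zero] using ha0 _
    · rw [hx.1 h, cutoff_of_lt 0 h, sub_self]
  · filter_upwards [hopt] with x hx hne
    rcases hne.lt_or_gt with h | h
    · rw [hx.2 h, cutoff_of_gt 0 h, sub_self]
    · rw [hx.1 h, cutoff_of_lt 0 h, sub_self]

lemma integral_accept_le_profit (hm : IsPosteriorMean τ m) (ha : Measurable a)
    (ha0 : ∀ t, 0 ≤ a t) (ha1 : ∀ t, a t ≤ 1)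
    (hopt : ∀ᵐ x ∂τ.P, (p < m x.2.1 → a x.2.1 = 1) ∧ (m x.2.1 < p → a x.2.1 = 0)) :
    ∫ x, (p - Γ.c x.2.2) * a x.2.1 ∂τ.P ≤ profit (estimateLaw τ m) (cutoff p 1) p := by
  have hcut : Measurable fun t => cutoff p 1 (m t) := (measurable_cutoff p 1).comp hm.measurable
  have h := hm.integral_indifferent_nonneg (p := p) (ψ := fun t => cutoff p 1 (m t) - a t)
    (hcut.sub ha)
    (fun t => abs_le.2 ⟨by linarith [ha1 t, cutoff_nonneg zero_le_one p (m t)],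
      by linarith [ha0 t, cutoff_le_one (le_refl (1 : ℝ)) p (m t)]⟩) ?_ ?_
  · have i1 : Integrable (fun x => (p - Γ.c x.2.2) * a x.2.1) τ.P :=
      integrable_mul_weight (integrable_price_sub_cost p) (ha.comp measurable_signal) fun x =>
        abs_le.2 ⟨by linarith [ha0 x.2.1], ha1 x.2.1⟩
    have i2 : Integrable (fun x => (p - Γ.c x.2.2) * cutoff p 1 (m x.2.1)) τ.P :=
      integrable_mul_cutoff (integrable_price_sub_cost p) hm.measurable_comp zero_le_one le_rfl p
    simp only [mul_sub] at h
    rw [integral_sub i2 i1] at h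
    rw [hm.profit_estimateLaw (measurable_cutoff p 1)]
    linarith
  · filter_upwards [hopt] with x hx
    rcases le_or_gt p (m x.2.1) with h | h
    · rw [cutoff_one_of_le h]; exact sub_nonneg.2 (ha1 _)
    · rw [hx.2 h, cutoff_of_gt 1 h, sub_self]
  · filter_upwards [hopt] with x hx hne
    rcases hne.lt_or_gt with h | h
    · rw [hx.2 h, cutoff_of_gt 1 h, sub_self]
    · rw [hx.1 h, cutoff_of_lt 1 h, sub_self]

lemma integral_accept_eq_buyerSurplus (hm : IsPosteriorMean τ m) (ha : Measurable a)
    (ha0 : ∀ t, 0 ≤ a t) (ha1 : ∀ t, a t ≤ 1)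
    (hopt : ∀ᵐ x ∂τ.P, (p < m x.2.1 → a x.2.1 = 1) ∧ (m x.2.1 < p → a x.2.1 = 0)) :
    ∫ x, ((x.2.2 : ℝ) - p) * a x.2.1 ∂τ.P = buyerSurplus (estimateLaw τ m) p := by
  have habs : ∀ t, |a t| ≤ 1 := fun t => abs_le.2 ⟨by linarith [ha0 t], ha1 t⟩
  have i1 : Integrable (fun x => ((x.2.2 : ℝ) - m x.2.1) * a x.2.1) τ.P :=
    integrable_mul_weight hm.integrable_value_sub (ha.comp measurable_signal) fun x => habs _
  have i2 : Integrable (fun x => max (m x.2.1 - p) 0) τ.P :=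
    (hm.integrable.sub (integrable_const p)).pos_part
  have e : ∫ x, (((x.2.2 : ℝ) - m x.2.1) * a x.2.1 + max (m x.2.1 - p) 0) ∂τ.P =
      buyerSurplus (estimateLaw τ m) p := by
    rw [integral_add i1 i2, hm.mean a ha habs, zero_add, hm.buyerSurplus_estimateLaw]
  rw [← e]
  refine integral_congr_ae ?_
  filter_upwards [hopt] with x hx
  rcases lt_trichotomy (m x.2.1) p with h | h | h
  · rw [hx.2 h, max_eq_right (by linarith)]; ring
  · rw [h, sub_self, max_self]; ring
  · rw [hx.1 h, max_eq_left (by linarith)]; ring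

end IsPosteriorMean

/-! ### Equilibria with price-independent beliefs -/

section PriceIndependent

variable {σ : SellerStrategy τ} {α : BuyerStrategy τ} {ν : Kernel (ℝ × τ.Tb) Γ.V}

lemma PriceIndependent.isPosteriorMean [IsMarkovKernel ν] (hν : PriceIndependent ν) (p : ℝ) :
    IsPosteriorMean τ fun t => ∫ v : Γ.V, (v : ℝ) ∂(ν (p, t)) :=
  isPosteriorMean_of_compProd_eq (hν p)

/-- With price-independent beliefs, Buyer compares every price, on or off path, with the same
posterior mean. -/
lemma IsWPBE.ae_accept (h : IsWPBE σ α ν) (hν : PriceIndependent ν) {m : τ.Tb → ℝ}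
    (hm : IsPosteriorMean τ m) (p : ℝ) :
    ∀ᵐ x ∂τ.P, (p < m x.2.1 → α.prob (p, x.2.1) = 1) ∧ (m x.2.1 < p → α.prob (p, x.2.1) = 0) := by
  have := h.isMarkovKernel
  filter_upwards [hm.ae_eq (hν.isPosteriorMean p)] with x hx
  rw [hx]
  exact h.buyer_opt p x.2.1

lemma IsWPBE.profit_le_sellerPayoffAt (h : IsWPBE σ α ν) (hν : PriceIndependent ν)
    {m : τ.Tb → ℝ} (hm : IsPosteriorMean τ m) (p : ℝ) :
    profit (estimateLaw τ m) (cutoff p 0) p ≤ sellerPayoffAt α p :=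
  hm.profit_le_integral_accept (measurable_accept_price α p) (fun _ => (α.prob_mem _).1)
    (fun _ => (α.prob_mem _).2) (h.ae_accept hν hm p)

lemma IsWPBE.sellerPayoffAt_le_profit (h : IsWPBE σ α ν) (hν : PriceIndependent ν)
    {m : τ.Tb → ℝ} (hm : IsPosteriorMean τ m) (p : ℝ) :
    sellerPayoffAt α p ≤ profit (estimateLaw τ m) (cutoff p 1) p :=
  hm.integral_accept_le_profit (measurable_accept_price α p) (fun _ => (α.prob_mem _).1)
    (fun _ => (α.prob_mem _).2) (h.ae_accept hν hm p)

lemma IsWPBE.buyerPayoffAt_eq (h : IsWPBE σ α ν) (hν : PriceIndependent ν)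
    {m : τ.Tb → ℝ} (hm : IsPosteriorMean τ m) (p : ℝ) :
    buyerPayoffAt α p = buyerSurplus (estimateLaw τ m) p :=
  hm.integral_accept_eq_buyerSurplus (measurable_accept_price α p) (fun _ => (α.prob_mem _).1)
    (fun _ => (α.prob_mem _).2) (h.ae_accept hν hm p)

/-- Even an informed Seller may post a constant price, so her payoff caps the profits of the
experiment that Buyer's signal induces. -/
lemma IsWPBE.caps (h : IsWPBE σ α ν) (hν : PriceIndependent ν) {m : τ.Tb → ℝ}
    (hm : IsPosteriorMean τ m) : Caps (estimateLaw τ m) (sellerPayoff σ α) := fun p =>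
  calc profit (estimateLaw τ m) (cutoff p 0) p ≤ sellerPayoffAt α p :=
        h.profit_le_sellerPayoffAt hν hm p
    _ = sellerPayoff (constPrice τ p) α := (sellerPayoff_constPrice p α).symm
    _ ≤ sellerPayoff σ α := h.seller_opt _ (payoffsDefined_constPrice p α)

/-- Beliefs that ignore the price satisfy Bayes' rule when Seller posts a constant price. -/
lemma PriceIndependent.bayes_constPrice [IsMarkovKernel ν] (hν : PriceIndependent ν) (p : ℝ) :
    ((outcome τ (constPrice τ p)).map fun x => (x.2, x.1.2.1)) ⊗ₘ ν =
      (outcome τ (constPrice τ p)).map fun x => ((x.2, x.1.2.1), x.1.2.2) := by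
  have hmk : Measurable fun x : τ.Ts × τ.Tb × Γ.V => (x, p) := measurable_prodMk_right
  have hm1 : Measurable fun x : (τ.Ts × τ.Tb × Γ.V) × ℝ => (x.2, x.1.2.1) :=
    measurable_snd.prodMk (measurable_signal.comp measurable_fst)
  have hm2 : Measurable fun x : (τ.Ts × τ.Tb × Γ.V) × ℝ => ((x.2, x.1.2.1), x.1.2.2) :=
    hm1.prodMk (measurable_value.comp measurable_fst)
  have hp : Measurable fun t : τ.Tb => (p, t) := measurable_prodMk_left
  have hpv : Measurable fun y : τ.Tb × Γ.V => ((p, y.1), y.2) :=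
    (hp.comp measurable_fst).prodMk measurable_snd
  have e1 : (τ.P.map fun x => (x, p)).map (fun x => (x.2, x.1.2.1)) =
      τ.P.snd.fst.map fun t => (p, t) := by
    rw [Measure.map_map hm1 hmk, Measure.snd, Measure.fst,
      Measure.map_map measurable_fst measurable_snd,
      Measure.map_map hp (measurable_fst.comp measurable_snd)]
    rfl
  have e2 : (τ.P.map fun x => (x, p)).map (fun x => ((x.2, x.1.2.1), x.1.2.2)) =
      τ.P.snd.map fun y => ((p, y.1), y.2) := by
    rw [Measure.map_map hm2 hmk, Measure.snd, Measure.map_map hpv measurable_snd]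
    rfl
  rw [outcome_constPrice, e1, e2]
  conv_rhs => rw [← hν p]
  have hpp : IsProbabilityMeasure (τ.P.snd.fst.map fun t => (p, t)) :=
    Measure.isProbabilityMeasure_map hp.aemeasurable
  ext s hs
  rw [Measure.compProd_apply hs, lintegral_map (Kernel.measurable_kernel_prodMk_left hs) hp,
    Measure.map_apply hpv hs, Measure.compProd_apply (hpv hs)]
  rfl

end PriceIndependent

/-! ### Implementation with an uninformed Seller -/

instance : Nonempty Γ.V := Γ.nontrivial_V.nonempty.to_subtype

lemma measurable_unit_prod : Measurable fun x : ℝ × Γ.V => ((), x) :=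
  measurable_const.prodMk measurable_id

/-- The information structure in which Seller knows nothing and Buyer's signal is the estimate of
the experiment `G`. -/
def ofExperiment (G : Measure (ℝ × Γ.V)) (hG : IsExperiment G) : InfoStructure Γ where
  Ts := Unit
  Tb := ℝ
  topTs := inferInstance
  topTb := inferInstance
  polishTs := inferInstance
  polishTb := inferInstance
  measTs := inferInstance
  measTb := inferInstance
  borelTs := inferInstance
  borelTb := inferInstance
  P := G.map fun x => ((), x)
  isProbabilityMeasure_P :=
    have := hG.isProbabilityMeasure
    Measure.isProbabilityMeasure_map measurable_unit_prod.aemeasurable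
  marginal_value := by
    have hv : Measurable fun x : Unit × ℝ × Γ.V => x.2.2 := measurable_snd.comp measurable_snd
    rw [Measure.map_map hv measurable_unit_prod, ← hG.snd_eq]
    rfl

lemma uninformedSeller_ofExperiment (hG : IsExperiment G) :
    UninformedSeller (ofExperiment G hG) := inferInstanceAs (Subsingleton Unit)

lemma snd_ofExperiment (hG : IsExperiment G) : (ofExperiment G hG).P.snd = G := by
  change (G.map fun x => ((), x)).map Prod.snd = G
  rw [Measure.map_map measurable_snd measurable_unit_prod]
  exact Measure.map_id

lemma isPosteriorMean_ofExperiment (hG : IsExperiment G) :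
    IsPosteriorMean (ofExperiment G hG) (fun t : ℝ => t) := by
  refine ⟨measurable_id, ?_, fun ψ hψ hψ1 => ?_⟩
  · obtain ⟨B, hB⟩ := hG.bounded
    refine ⟨B, ?_⟩
    change ∀ᵐ x ∂(G.map fun x => ((), x)), |x.2.1| ≤ B
    have hm : Measurable fun x : Unit × ℝ × Γ.V => |x.2.1| :=
      (measurable_fst.comp measurable_snd).abs
    rwa [ae_map_iff measurable_unit_prod.aemeasurable (measurableSet_le hm measurable_const)]
  · have hψ' : Measurable (ψ : ℝ → ℝ) := hψ
    have hmf : Measurable fun x : Unit × ℝ × Γ.V => ((x.2.2 : ℝ) - x.2.1) * ψ x.2.1 :=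
      ((measurable_subtype_coe.comp (measurable_snd.comp measurable_snd)).sub
        (measurable_fst.comp measurable_snd)).mul
        (hψ'.comp (measurable_fst.comp measurable_snd))
    change ∫ x, ((x.2.2 : ℝ) - x.2.1) * ψ x.2.1 ∂(G.map fun x => ((), x)) = 0
    rw [integral_map measurable_unit_prod.aemeasurable hmf.aestronglyMeasurable]
    exact hG.mean ψ hψ hψ1

lemma estimateLaw_ofExperiment (hG : IsExperiment G) :
    estimateLaw (ofExperiment G hG) (fun t : ℝ => t) = G :=
  snd_ofExperiment hG

/-- Against an uninformed Seller's mixed strategy, payoffs average the payoffs at fixed prices. -/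
lemma PayoffsDefined.eq_integral {τ : InfoStructure Γ} {σ : SellerStrategy τ}
    {α : BuyerStrategy τ} (h : PayoffsDefined σ α) {q : Measure ℝ} [IsProbabilityMeasure q]
    (hq : outcome τ σ = τ.P.prod q) :
    Integrable (sellerPayoffAt α) q ∧ sellerPayoff σ α = ∫ p, sellerPayoffAt α p ∂q ∧
      buyerPayoff σ α = ∫ p, buyerPayoffAt α p ∂q := by
  rw [PayoffsDefined, hq] at h
  refine ⟨h.2.integral_prod_right, ?_, ?_⟩
  · rw [sellerPayoff, hq, integral_prod_symm _ h.2]; rfl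
  · rw [buyerPayoff, hq, integral_prod_symm _ h.1]; rfl

/-- A profit-maximising price of an experiment is part of an equilibrium with price-independent
beliefs, in which an indifferent Buyer accepts. -/
theorem mem_eqPayoffsStar_ofExperiment (hG : IsExperiment G) {z : ℝ}
    (hz : ∀ p, profit G (cutoff p 1) p ≤ profit G (cutoff z 1) z) :
    (buyerSurplus G z, profit G (cutoff z 1) z) ∈ eqPayoffsStar (ofExperiment G hG) := by
  have := hG.isProbabilityMeasure
  set τ := ofExperiment G hG with hτ
  let κ : Kernel τ.Tb Γ.V := G.condKernel
  have hκ : IsMarkovKernel κ := inferInstanceAs (IsMarkovKernel G.condKernel)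
  have hdis : τ.P.snd.fst ⊗ₘ κ = τ.P.snd := by
    rw [snd_ofExperiment hG]
    exact G.disintegrate G.condKernel
  let ν : Kernel (ℝ × τ.Tb) Γ.V := κ.comap Prod.snd measurable_snd
  have hνM : IsMarkovKernel ν := inferInstanceAs (IsMarkovKernel (κ.comap _ _))
  have hν : PriceIndependent ν := fun p => hdis
  let M : τ.Tb → ℝ := fun t => ∫ v : Γ.V, (v : ℝ) ∂(κ t)
  have hM : IsPosteriorMean τ M := isPosteriorMean_of_compProd_eq hdis
  have hid : IsPosteriorMean τ (fun t : ℝ => t) := isPosteriorMean_ofExperiment hG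
  have hlaw : estimateLaw τ (fun t : ℝ => t) = G := estimateLaw_ofExperiment hG
  let α : BuyerStrategy τ :=
    { prob := fun x => cutoff x.1 1 (M x.2)
      measurable_prob := (measurable_cutoff_uncurry 1).comp
        (measurable_fst.prodMk (hM.measurable.comp measurable_snd))
      prob_mem := fun x => ⟨cutoff_nonneg zero_le_one _ _, cutoff_le_one le_rfl _ _⟩ }
  have hopt : ∀ (p : ℝ) (t : τ.Tb), (p < M t → α.prob (p, t) = 1) ∧
      (M t < p → α.prob (p, t) = 0) := fun p t => ⟨cutoff_of_lt 1, cutoff_of_gt 1⟩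
  have hacc : ∀ p, ∀ᵐ x ∂τ.P, (p < x.2.1 → α.prob (p, x.2.1) = 1) ∧
      (x.2.1 < p → α.prob (p, x.2.1) = 0) := fun p => by
    filter_upwards [hid.ae_eq hM] with x hx
    have h := hopt p x.2.1
    rwa [← hx] at h
  have hat : ∀ p, sellerPayoffAt α p = profit G (cutoff p 1) p := fun p => by
    rw [← hlaw, hid.profit_estimateLaw (measurable_cutoff p 1)]
    refine integral_congr_ae ?_
    filter_upwards [hid.ae_eq hM] with x hx
    change (p - Γ.c x.2.2) * cutoff p 1 (M x.2.1) = _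
    rw [← hx]
  have hbuy : buyerPayoffAt α z = buyerSurplus G z := by
    have h := hid.integral_accept_eq_buyerSurplus (measurable_accept_price α z)
      (fun _ => (α.prob_mem _).1) (fun _ => (α.prob_mem _).2) (hacc z)
    rwa [hlaw] at h
  refine ⟨constPrice τ z, α, ν, ⟨hνM, payoffsDefined_constPrice z α, hopt, fun σ' hσ' => ?_,
    hν.bayes_constPrice z⟩, hν, ?_⟩
  · obtain ⟨q, hq, hout⟩ := exists_outcome_eq_prod (uninformedSeller_ofExperiment hG) σ'
    obtain ⟨hi, hs, -⟩ := hσ'.eq_integral hout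
    rw [hs, sellerPayoff_constPrice]
    calc ∫ p, sellerPayoffAt α p ∂q ≤ ∫ _, sellerPayoffAt α z ∂q :=
          integral_mono hi (integrable_const _) fun p => by
            simp only [hat]; exact hz p
      _ = sellerPayoffAt α z := by simp
  · rw [buyerPayoff_constPrice, sellerPayoff_constPrice, hat, hbuy]

/-- If the profit-maximising price is unique, so is the equilibrium payoff pair: Seller must post
that price, and Buyer's payoff at a given price does not depend on how ties are broken. -/
theorem eqPayoffsStar_ofExperiment_subset (hG : IsExperiment G) {z : ℝ}
    (hz : ∀ p, p ≠ z → profit G (cutoff p 1) p < profit G (cutoff z 1) z) :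
    eqPayoffsStar (ofExperiment G hG) ⊆ {(buyerSurplus G z, profit G (cutoff z 1) z)} := by
  rintro _ ⟨σ, α, ν, h, hν, rfl⟩
  set s := profit G (cutoff z 1) z with hs
  have hid := isPosteriorMean_ofExperiment hG
  have hcap := h.caps hν hid
  have hle := h.sellerPayoffAt_le_profit hν hid
  have hbuy := h.buyerPayoffAt_eq hν hid
  rw [estimateLaw_ofExperiment hG] at hcap hle hbuy
  obtain ⟨q, hq, hout⟩ := exists_outcome_eq_prod (uninformedSeller_ofExperiment hG) σ
  obtain ⟨hi, hsel, hbuyer⟩ := h.payoffsDefined.eq_integral hout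
  have hs_le : ∀ p, sellerPayoffAt α p ≤ s := fun p => by
    by_cases hp : p = z
    · rw [hp]; exact hle z
    · exact (hle p).trans (hz p hp).le
  have hge : s ≤ ∫ p, sellerPayoffAt α p ∂q := hsel ▸ hcap.profit_cutoff_one_le hG z
  -- Seller's payoff averages values that are at most `s`, yet is at least `s`: all prices posted
  -- earn `s`, and only `z` can.
  have hgap : Integrable (fun p => s - sellerPayoffAt α p) q := (integrable_const s).sub hi
  have hgap0 : ∫ p, (s - sellerPayoffAt α p) ∂q = 0 := by
    refine le_antisymm ?_ (integral_nonneg fun p => sub_nonneg.2 (hs_le p))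
    rw [integral_sub (integrable_const s) hi]
    simp only [integral_const, probReal_univ, one_smul]
    linarith
  have hae : ∀ᵐ p ∂q, p = z ∧ sellerPayoffAt α p = s := by
    filter_upwards [(integral_eq_zero_iff_of_nonneg (fun p => sub_nonneg.2 (hs_le p)) hgap).1
      hgap0] with p hp
    have hp' : sellerPayoffAt α p = s := (sub_eq_zero.1 hp).symm
    refine ⟨?_, hp'⟩
    by_contra hne
    exact absurd (hle p) (not_le.2 (hp' ▸ hz p hne))
  rw [Set.mem_singleton_iff, hsel, hbuyer, Prod.mk.injEq]
  constructor
  · rw [integral_congr_ae (g := fun _ => buyerSurplus G z) (hae.mono fun p hp => by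
      simp only [hbuy, hp.1])]
    simp
  · rw [integral_congr_ae (g := fun _ => s) (hae.mono fun p hp => hp.2)]
    simp

/-! ### Payoff sets -/

lemma UninformedSeller.moreInformedBuyer {τ : InfoStructure Γ} (h : UninformedSeller τ) :
    MoreInformedBuyer τ := by
  obtain ⟨x⟩ := nonempty_of_isProbabilityMeasure τ.P
  have hconst : (fun y : τ.Ts × τ.Tb × Γ.V => y.1) = fun _ => x.1 :=
    funext fun y => @Subsingleton.elim _ h _ _
  rw [MoreInformedBuyer, hconst]
  exact condIndepFun_const_left _ _

variable (Γ)

lemma implementableStarUS_subset_MB : implementableStarUS Γ ⊆ implementableStarMB Γ :=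
  Set.biUnion_subset_biUnion_left fun _ h => h.moreInformedBuyer

lemma implementableStarMB_subset : implementableStarMB Γ ⊆ implementableStar Γ :=
  Set.iUnion₂_subset fun τ _ => Set.subset_iUnion eqPayoffsStar τ

lemma implementableStar_subset_implementable : implementableStar Γ ⊆ implementable Γ :=
  Set.iUnion_mono fun _ _ ⟨σ, α, ν, h, _, e⟩ => ⟨σ, α, ν, h, e⟩

variable {Γ}

lemma nonneg_and_add_le_of_mem_implementable {π : ℝ × ℝ} (h : π ∈ implementable Γ) :
    0 ≤ π.1 ∧ π.1 + π.2 ≤ totalSurplus Γ := by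
  obtain ⟨τ, σ, α, ν, hE, rfl⟩ := Set.mem_iUnion.1 h
  exact ⟨hE.buyerPayoff_nonneg, hE.payoffsDefined.add_le⟩

lemma exists_caps_of_mem_implementableStar {π : ℝ × ℝ} (h : π ∈ implementableStar Γ) :
    ∃ G : Measure (ℝ × Γ.V), IsExperiment G ∧ Caps G π.2 := by
  obtain ⟨τ, σ, α, ν, hE, hν, rfl⟩ := Set.mem_iUnion.1 h
  have := hE.isMarkovKernel
  -- Beliefs at the price `0` serve as the reference; any price would do.
  have hm := hν.isPosteriorMean 0
  exact ⟨_, hm.isExperiment, hE.caps hν hm⟩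

/-- A payoff pair that respects the welfare bounds and gives Seller at least a profit cap of some
experiment is implementable with an uninformed Seller, and uniquely so if it gives her more. -/
lemma exists_uninformed_of_caps {t : ℝ} (hG : IsExperiment G) (hcap : Caps G t) {π : ℝ × ℝ}
    (ht : t ≤ π.2) (hb : 0 ≤ π.1) (hbs : π.1 + π.2 ≤ totalSurplus Γ) :
    ∃ τ : InfoStructure Γ, UninformedSeller τ ∧ π ∈ eqPayoffsStar τ ∧
      (t < π.2 → eqPayoffsStar τ = {π}) := by
  obtain ⟨G', z, hG', hle, hs, hb', hlt⟩ := exists_experiment_of_caps hG hcap ht hb hbs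
  have hπ : (buyerSurplus G' z, profit G' (cutoff z 1) z) = π := Prod.ext hb' hs
  have hmem := mem_eqPayoffsStar_ofExperiment hG' (z := z) fun p => hs ▸ hle p
  rw [hπ] at hmem
  refine ⟨ofExperiment G' hG', uninformedSeller_ofExperiment hG', hmem, fun h => ?_⟩
  have hsub := eqPayoffsStar_ofExperiment_subset hG' (z := z) fun p hp => hs ▸ hlt h p hp
  rw [hπ] at hsub
  exact hsub.antisymm (Set.singleton_subset_iff.2 hmem)

end BilateralTrade

end

theorem theorem2 (Γ : BilateralTrade.Environment) :
    (BilateralTrade.implementableStar Γ = BilateralTrade.implementableStarMB Γ ∧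
      BilateralTrade.implementableStarMB Γ = BilateralTrade.implementableStarUS Γ) ∧
    (BilateralTrade.implementableStarUS Γ =
        {π : ℝ × ℝ | π ∈ BilateralTrade.implementable Γ ∧
          BilateralTrade.sellerFloorUS Γ ≤ π.2} ∧
      IsLeast (BilateralTrade.sellerPayoffsUS Γ) (BilateralTrade.sellerFloorUS Γ)) ∧
    (∀ π ∈ BilateralTrade.implementableStarUS Γ, BilateralTrade.sellerFloorUS Γ < π.2 →
      ∃ τ : BilateralTrade.InfoStructure Γ, BilateralTrade.UninformedSeller τ ∧
        BilateralTrade.eqPayoffsStar τ = {π}) := by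
  open BilateralTrade in
  obtain ⟨t₀, ⟨G, hG, hcap⟩, ht₀, hleast⟩ := exists_least_cap Γ
  have hUS_sub : implementableStarUS Γ ⊆ implementableStar Γ :=
    (implementableStarUS_subset_MB Γ).trans (implementableStarMB_subset Γ)
  have hge : ∀ π ∈ implementableStar Γ, t₀ ≤ π.2 := fun π hπ => by
    obtain ⟨G', hG', hcap'⟩ := exists_caps_of_mem_implementableStar hπ
    exact hleast G' _ hG' hcap'
  have hmem : ∀ π : ℝ × ℝ, π ∈ implementable Γ → t₀ ≤ π.2 → π ∈ implementableStarUS Γ :=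
    fun π hπ ht => by
      obtain ⟨hb, hbs⟩ := nonneg_and_add_le_of_mem_implementable hπ
      obtain ⟨τ, hτ, hπτ, -⟩ := exists_uninformed_of_caps hG hcap ht hb hbs
      exact Set.mem_biUnion (show τ ∈ {τ : InfoStructure Γ | UninformedSeller τ} from hτ) hπτ
  have hstar : implementableStar Γ ⊆ implementableStarUS Γ := fun π hπ =>
    hmem π (implementableStar_subset_implementable Γ hπ) (hge π hπ)
  have hfloor : IsLeast (sellerPayoffsUS Γ) t₀ := by
    refine ⟨⟨0, ?_⟩, fun s ⟨b, hs⟩ => hge _ (hUS_sub hs)⟩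
    obtain ⟨τ, hτ, hπτ, -⟩ := exists_uninformed_of_caps hG hcap (π := (0, t₀)) le_rfl le_rfl
      (by simpa using ht₀)
    exact Set.mem_biUnion (show τ ∈ {τ : InfoStructure Γ | UninformedSeller τ} from hτ) hπτ
  have heq : sellerFloorUS Γ = t₀ := hfloor.csInf_eq
  rw [heq]
  refine ⟨⟨?_, ?_⟩, ⟨?_, hfloor⟩, fun π hπ ht => ?_⟩
  · exact (hstar.trans (implementableStarUS_subset_MB Γ)).antisymm (implementableStarMB_subset Γ)
  · exact ((implementableStarMB_subset Γ).trans hstar).antisymm (implementableStarUS_subset_MB Γ)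
  · exact Set.Subset.antisymm (fun π hπ =>
      ⟨implementableStar_subset_implementable Γ (hUS_sub hπ), hge π (hUS_sub hπ)⟩)
      fun π hπ => hmem π hπ.1 hπ.2
  · obtain ⟨hb, hbs⟩ := nonneg_and_add_le_of_mem_implementable
      (implementableStar_subset_implementable Γ (hUS_sub hπ))
    obtain ⟨τ, hτ, -, huniq⟩ := exists_uninformed_of_caps hG hcap ht.le hb hbs
    exact ⟨τ, hτ, huniq ht⟩
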